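/- Let $k$ be a field, $G$ a finite group and $V$ a finite dimensional representation of $G$ over $k$. Let $B=k[V]$ be the polynomial ring on a basis of $V$, graded with $V$ in degree $1$ and with the induced action of $G$, and let $R=B^G$. Let $I\subseteq B$ be the ideal generated by the homogeneous elements of $R$ of positive degree, and let $\tau_G(V)$ be the smallest positive integer $d$ such that $I_d=B_d$. Let $f_1,\dots,f_r$ be a minimal set of homogeneous generators of the $k$-algebra $R$, and let $S=k[x_1,\dots,x_r]$ be graded by $\deg x_j=\deg f_j$ and act on $R$ through $x_j\mapsto f_j$. For a graded module $M$ over $A=S$ or $A=B$ and $i\ge 0$, let $t_i^A(M)\in\mathbb Z\cup\{\pm\infty\}$ be the largest degree in which the graded module $\operatorname{Tor}_i^A(M,k)$ is not zero, where $k=A/A_+$ ($-\infty$ if it is zero, $+\infty$ if the degrees are unbounded). Suppose that $\operatorname{char} k$ does not divide $|G|$ or, more generally, that the inclusion $R\hookrightarrow B$ is split as a map of $R$-modules. Then, for every $i\ge 0$, $$t_i^S(R)\le (i+1)\tau_G(V)+i-1\le (i+1)|G|+i-1 .$$ If, furthermore, $t_1^B(I)\le\tau_G(V)$, then, for every $i\ge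 0$, $$t_i^S(R)\le (i+1)\tau_G(V)-1\le (i+1)|G|-1 .$$ -/

import Mathlib

universe u v w

noncomputable section

/-- The ideal `A₊` generated by the homogeneous elements of positive degree. -/
def positiveIdeal {k : Type u} {A : Type v} [Field k] [CommRing A] [Algebra k A]
    (𝒜 : ℕ → Submodule k A) : Ideal A :=
  Ideal.span {a | ∃ n, 0 < n ∧ a ∈ 𝒜 n}

/-- The degree `n` part of the graded free module with one basis element of degree `deg j`
for each `j`: the coefficient at `j` is homogeneous of degree `n - deg j`. -/
def freePiece {k : Type u} {A : Type v} {J : Type w} [Field k] [CommRing A] [Algebra k A]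
    (𝒜 : ℕ → Submodule k A) (deg : J → ℕ) (n : ℕ) : Set (J →₀ A) :=
  {x | ∀ j, x j ∈ if deg j ≤ n then 𝒜 (n - deg j) else (⊥ : Submodule k A)}

/-- A graded free resolution `⋯ → F₁ → F₀ → M → 0` of a graded module `M` over a graded
`k`-algebra `A`. The term `Fᵢ` is free on homogeneous basis elements indexed by `J i`, and all
the maps preserve degree. -/
structure GradedFreeResolution {k : Type u} {A : Type v} {M : Type w} [Field k] [CommRing A]
    [Algebra k A] [AddCommGroup M] [Module k M] [Module A M]
    (𝒜 : ℕ → Submodule k A) (ℳ : ℕ → Submodule k M) where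
  J : ℕ → Type (max v w)
  deg : (i : ℕ) → J i → ℕ
  d : (i : ℕ) → (J (i + 1) →₀ A) →ₗ[A] (J i →₀ A)
  ε : (J 0 →₀ A) →ₗ[A] M
  d_graded : ∀ i n, ∀ x ∈ freePiece 𝒜 (deg (i + 1)) n, d i x ∈ freePiece 𝒜 (deg i) n
  ε_graded : ∀ n, ∀ x ∈ freePiece 𝒜 (deg 0) n, ε x ∈ ℳ n
  ε_surjective : Function.Surjective ε
  exact_zero : Function.Exact (d 0) ε
  exact_succ : ∀ i, Function.Exact (d (i + 1)) (d i)

namespace GradedFreeResolution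

variable {k : Type u} {A : Type v} {M : Type w} [Field k] [CommRing A]
  [Algebra k A] [AddCommGroup M] [Module k M] [Module A M]
  {𝒜 : ℕ → Submodule k A} {ℳ : ℕ → Submodule k M}

/-- The elements of `Fᵢ` whose images in `F ⊗ A/A₊ = F/A₊F` are cycles; the complex is zero in
negative homological degrees. -/
def cycles (F : GradedFreeResolution 𝒜 ℳ) : (i : ℕ) → Submodule A (F.J i →₀ A)
  | 0 => ⊤
  | i + 1 => (positiveIdeal 𝒜 • (⊤ : Submodule A (F.J i →₀ A))).comap (F.d i)

/-- The elements of `Fᵢ` whose images in `F ⊗ A/A₊ = F/A₊F` are boundaries. -/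
def boundaries (F : GradedFreeResolution 𝒜 ℳ) (i : ℕ) : Submodule A (F.J i →₀ A) :=
  positiveIdeal 𝒜 • (⊤ : Submodule A (F.J i →₀ A)) ⊔ LinearMap.range (F.d i)

/-- `Tor_i(M, A/A₊)`, the `i`th homology of `F ⊗ A/A₊ = F/A₊F`: cycles modulo boundaries. -/
def Tor (F : GradedFreeResolution 𝒜 ℳ) (i : ℕ) :
    Submodule A ((F.J i →₀ A) ⧸ F.boundaries i) :=
  (F.cycles i).map (F.boundaries i).mkQ

/-- The internal degree `n` part of `Tor_i(M, A/A₊)`: the classes of the cycles that are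
homogeneous of degree `n`. -/
def torPiece (F : GradedFreeResolution 𝒜 ℳ) (i n : ℕ) : Set (F.Tor i) :=
  {c | ∃ z ∈ F.cycles i, z ∈ freePiece 𝒜 (F.deg i) n ∧ (F.boundaries i).mkQ z = c}

end GradedFreeResolution

/-- The end of a graded module: the largest degree in which it is not zero, `⊤` if the degrees
are not bounded and `⊥` if the module is zero. -/
def gradedEnd {T : Type w} [Zero T] (𝒯 : ℕ → Set T) : EReal :=
  ⨆ (n : ℕ) (_ : ∃ c ∈ 𝒯 n, c ≠ 0), (n : EReal)

/-- `t_i^A(M)`, the end of `Tor_i^A(M, k)` where `k = A/A₊`. All graded free resolutions of `M`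
give the same graded `Tor`, so the supremum is over equal values. -/
def torEnd {k : Type u} {A : Type v} {M : Type w} [Field k] [CommRing A]
    [Algebra k A] [AddCommGroup M] [Module k M] [Module A M]
    (𝒜 : ℕ → Submodule k A) (ℳ : ℕ → Submodule k M) (i : ℕ) : EReal :=
  ⨆ F : GradedFreeResolution 𝒜 ℳ, gradedEnd (F.torPiece i)

section Invariants

open MvPolynomial

variable {k : Type u} [Field k] {G : Type v} [Group G]
  {V : Type w} [AddCommGroup V] [Module k V] {ι : Type} [Fintype ι]

/-- The action of `g` on `k[V]`, the polynomial ring on a basis `b` of `V`, by the `k`-algebra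
endomorphism that extends the action of `g` on the span `V` of the variables. -/
def polyAction (b : Module.Basis ι k V) (ρ : Representation k G V) (g : G) :
    MvPolynomial ι k →ₐ[k] MvPolynomial ι k :=
  aeval fun i => ∑ j, C (b.repr (ρ g (b i)) j) * X j

/-- The ring of invariants `R = k[V]^G`. -/
def invariantRing (b : Module.Basis ι k V) (ρ : Representation k G V) :
    Subalgebra k (MvPolynomial ι k) :=
  ⨅ g : G, AlgHom.equalizer (polyAction b ρ g) (AlgHom.id k (MvPolynomial ι k))

/-- The degree `n` part of `R`. -/
def invariantPiece (b : Module.Basis ι k V) (ρ : Representation k G V) (n : ℕ) :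
    Submodule k (invariantRing b ρ) :=
  (homogeneousSubmodule ι k n).comap (invariantRing b ρ).val.toLinearMap

/-- The ideal `I` of `k[V]` generated by the invariants of positive degree. -/
def hilbertIdeal (b : Module.Basis ι k V) (ρ : Representation k G V) :
    Ideal (MvPolynomial ι k) :=
  Ideal.span {p | p ∈ invariantRing b ρ ∧ ∃ n, 0 < n ∧ p.IsHomogeneous n}

/-- The degree `n` part of `I`. -/
def hilbertIdealPiece (b : Module.Basis ι k V) (ρ : Representation k G V) (n : ℕ) :
    Submodule k (hilbertIdeal b ρ) :=
  (homogeneousSubmodule ι k n).comap ((hilbertIdeal b ρ).subtype.restrictScalars k)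

/-- `τ_G(V)`, the smallest positive degree in which `I` and `k[V]` agree. -/
def tau (b : Module.Basis ι k V) (ρ : Representation k G V) : ℕ :=
  sInf {n | 0 < n ∧ ∀ p : MvPolynomial ι k, p.IsHomogeneous n → p ∈ hilbertIdeal b ρ}

/-- The inclusion of `R` in `k[V]` is split as a map of `R`-modules. -/
def IsSplitInvariants (b : Module.Basis ι k V) (ρ : Representation k G V) : Prop :=
  ∃ π : MvPolynomial ι k →ₗ[invariantRing b ρ] invariantRing b ρ,
    ∀ x : invariantRing b ρ, π (x : MvPolynomial ι k) = x

/-- The `f j` are homogeneous of degrees `e j` and form a minimal set of generators of the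
`k`-algebra `R`. -/
structure IsMinimalGenerators (b : Module.Basis ι k V) (ρ : Representation k G V) {r : ℕ}
    (f : Fin r → invariantRing b ρ) (e : Fin r → ℕ) : Prop where
  homogeneous : ∀ j, f j ∈ invariantPiece b ρ (e j)
  generates : Algebra.adjoin k (Set.range f) = ⊤
  minimal : ∀ j, Algebra.adjoin k (f '' {j}ᶜ) ≠ ⊤

/-- `t_i^S(R)`, where `S = k[x_1, …, x_r]` is graded by `deg x_j = e j` and acts on `R` through
the map of `k`-algebras `S → R` that sends `x_j` to `f j`. -/
def invariantTorEnd (b : Module.Basis ι k V) (ρ : Representation k G V) {r : ℕ}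
    (f : Fin r → invariantRing b ρ) (e : Fin r → ℕ) (i : ℕ) : EReal :=
  letI : Module (MvPolynomial (Fin r) k) (invariantRing b ρ) :=
    Module.compHom (invariantRing b ρ)
      (aeval f : MvPolynomial (Fin r) k →ₐ[k] invariantRing b ρ).toRingHom
  torEnd (weightedHomogeneousSubmodule k e) (invariantPiece b ρ) i

/-- `t_i^B(I)`, where `B = k[V]` is standard graded. -/
def hilbertIdealTorEnd (b : Module.Basis ι k V) (ρ : Representation k G V) (i : ℕ) : EReal :=
  torEnd (homogeneousSubmodule ι k) (hilbertIdealPiece b ρ) i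

end Invariants

end

/-!
By the splitting, `Tor_i^S(R, k)`, the Koszul homology `H_i(f; R)`, is a retract of `H_i(f; B)`, so
it suffices to show that `H_i(f; B)` vanishes in all degrees from some `β i` on.

Write `τ` for `τ_G(V)`. The degrees of the `f j` are at most `τ`, so a Koszul cycle `z` in
homological degree `q` and internal degree `d` has its coefficients in degrees at least `d - q τ`.
If `d ≥ β q ≥ (q + 1) τ`, they lie in `I`, hence are combinations of the `f j`, and `z` lifts to a
chain `g` with `z = ∑ f j • g j`. If the `g j` can be chosen to be cycles, then `z` is a boundary,
because multiplication by `f j` is null-homotopic. The obstruction is a class in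
`H_{q-1}(f; Syz I)`. A resolution of `I` over `B` reduces its vanishing to that of `H_p(f; B)` for
`p < q`, as soon as `β p + t_{q-p}(I) ≤ β q`.

Since `I` contains every form of degree at least `τ`, always `t_s(I) ≤ τ + s`, which permits
`β q = (q + 1) τ + q`. If `t_1(I) ≤ τ`, then `t_s(I) ≤ max(1, s) τ`, which permits
`β q = (q + 1) τ`; the only case in which this needs a further argument is `τ = 1`, where `I = B₊`
and the relation between two variables shows that there is at most one.
-/

noncomputable section

/-! ### Koszul complexes -/

namespace Koszul

/-- The chains `N ⊗ Λ(ℤ^l)` of the Koszul complex of a sequence indexed by the list `l`, with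
coefficients in `N`, built as an iterated mapping cone. -/
def Chains {σ : Type w} (N : Type v) : List σ → Type v
  | [] => N
  | _ :: l => Chains N l × Chains N l

section Chains

variable {σ : Type w} {N : Type v}

/-- A coefficient, as a chain of the Koszul complex of the empty sequence. -/
def single (y : N) : Chains N ([] : List σ) := y

/-- The chain `α + j ∧ β` of the Koszul complex of `j :: l`. -/
def pair (j : σ) {l : List σ} (α β : Chains N l) : Chains N (j :: l) := (α, β)

@[elab_as_elim]
theorem Chains.induction {motive : (l : List σ) → Chains N l → Prop}
    (single : ∀ y, motive [] (single y))
    (pair : ∀ j l α β, motive l α → motive l β → motive (j :: l) (pair j α β)) :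
    ∀ (l : List σ) (z : Chains N l), motive l z
  | [], z => single z
  | j :: l, z => pair j l z.1 z.2 (induction single pair l _) (induction single pair l _)

theorem exists_pair_eq {j : σ} {l : List σ} (z : Chains N (j :: l)) : ∃ α β, pair j α β = z :=
  ⟨z.1, z.2, rfl⟩

theorem pair_inj {j : σ} {l : List σ} {α β α' β' : Chains N l} :
    pair j α β = pair j α' β' ↔ α = α' ∧ β = β' := Prod.mk_inj

variable [AddCommGroup N] {A : Type u} [CommRing A] [Module A N]

instance Chains.instAddCommGroup : (l : List σ) → AddCommGroup (Chains N l)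
  | [] => inferInstanceAs (AddCommGroup N)
  | _ :: l =>
    letI := instAddCommGroup l
    inferInstanceAs (AddCommGroup (Chains N l × Chains N l))

instance Chains.instModule : (l : List σ) → Module A (Chains N l)
  | [] => inferInstanceAs (Module A N)
  | _ :: l =>
    letI := instModule l
    inferInstanceAs (Module A (Chains N l × Chains N l))

theorem pair_zero (j : σ) (l : List σ) : pair j (0 : Chains N l) 0 = 0 := rfl

theorem pair_add (j : σ) {l : List σ} (α β α' β' : Chains N l) :
    pair j α β + pair j α' β' = pair j (α + α') (β + β') := rfl

theorem smul_pair (a : A) (j : σ) {l : List σ} (α β : Chains N l) :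
    a • pair j α β = pair j (a • α) (a • β) := rfl

theorem sum_pair {J : Type*} (s : Finset J) (j : σ) {l : List σ} (α β : J → Chains N l) :
    ∑ i ∈ s, pair j (α i) (β i) = pair j (∑ i ∈ s, α i) (∑ i ∈ s, β i) :=
  Prod.ext (Prod.fst_sum (f := fun i => pair j (α i) (β i)))
    (Prod.snd_sum (f := fun i => pair j (α i) (β i)))

end Chains

section Complex

variable {σ : Type w} {N N' N'' : Type*} [AddCommGroup N] [AddCommGroup N'] [AddCommGroup N'']
  {A A' : Type*} [CommRing A] [CommRing A'] [Module A' N'] [Module A N]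

/-- The map of Koszul chains induced by a map of coefficients. -/
def map (φ : N →+ N') : (l : List σ) → Chains N l →+ Chains N' l
  | [] => φ
  | _ :: l => (map φ l).prodMap (map φ l)

/-- The Koszul differential of the sequence of the elements `x j`, for `j` in `l`. -/
def bd (x : σ → A) : (l : List σ) → Chains N l →ₗ[A] Chains N l
  | [] => 0
  | j :: l => LinearMap.prod
      (bd x l ∘ₗ LinearMap.fst A (Chains N l) (Chains N l) +
        x j • LinearMap.snd A (Chains N l) (Chains N l))
      (-(bd x l ∘ₗ LinearMap.snd A (Chains N l) (Chains N l)))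

theorem map_pair (φ : N →+ N') (j : σ) (l : List σ) (α β : Chains N l) :
    map φ (j :: l) (pair j α β) = pair j (map φ l α) (map φ l β) := rfl

theorem bd_pair (x : σ → A) (j : σ) (l : List σ) (α β : Chains N l) :
    bd x (j :: l) (pair j α β) = pair j (bd x l α + x j • β) (-bd x l β) := rfl

theorem map_map (φ : N →+ N') (ψ : N' →+ N'') (l : List σ) (z : Chains N l) :
    map ψ l (map φ l z) = map (ψ.comp φ) l z := by
  induction l, z using Chains.induction with
  | single => rfl
  | pair j l α β hα hβ => simp only [map_pair, hα, hβ]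

theorem map_id (l : List σ) (z : Chains N l) : map (AddMonoidHom.id N) l z = z := by
  induction l, z using Chains.induction with
  | single => rfl
  | pair j l α β hα hβ => simp only [map_pair, hα, hβ]

theorem map_zero_hom (l : List σ) (z : Chains N l) : map (0 : N →+ N') l z = 0 := by
  induction l, z using Chains.induction with
  | single => rfl
  | pair j l α β hα hβ => simp only [map_pair, hα, hβ, pair_zero]

theorem map_toAddMonoidHom (a : A) (l : List σ) (z : Chains N l) :
    map (DistribSMul.toAddMonoidHom N a) l z = a • z := by
  induction l, z using Chains.induction with
  | single => rfl
  | pair j l α β hα hβ => rw [map_pair, smul_pair, hα, hβ]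

theorem map_smul_of_forall {φ : N →+ N'} {a : A} {a' : A'} (h : ∀ y, φ (a • y) = a' • φ y)
    (l : List σ) (z : Chains N l) : map φ l (a • z) = a' • map φ l z := by
  rw [← map_toAddMonoidHom, ← map_toAddMonoidHom, map_map, map_map]
  exact congrArg (fun ψ => map ψ l z) (AddMonoidHom.ext h)

theorem map_injective {φ : N →+ N'} (h : Function.Injective φ) (l : List σ) :
    Function.Injective (map φ l) := by
  induction l with
  | nil => exact h
  | cons _ _ ih => exact ih.prodMap ih

theorem bd_map {φ : N →+ N'} {x : σ → A} {x' : σ → A'} {l : List σ}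
    (h : ∀ j ∈ l, ∀ y, φ (x j • y) = x' j • φ y) (z : Chains N l) :
    bd x' l (map φ l z) = map φ l (bd x l z) := by
  induction l, z using Chains.induction with
  | single => exact (map_zero φ).symm
  | pair j l α β hα hβ =>
    have hl : ∀ i ∈ l, ∀ y, φ (x i • y) = x' i • φ y := fun i hi => h i (List.mem_cons_of_mem j hi)
    simp only [map_pair, bd_pair, hα hl, hβ hl, map_add, map_neg,
      map_smul_of_forall (h j List.mem_cons_self)]

theorem bd_bd (x : σ → A) (l : List σ) (z : Chains N l) : bd x l (bd x l z) = 0 := by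
  induction l, z using Chains.induction with
  | single => rfl
  | pair j l α β hα hβ =>
    simp only [bd_pair, map_add, map_smul, map_neg, hα, hβ, smul_neg, zero_add, neg_zero,
      add_neg_cancel, pair_zero]

/-- The contracting homotopy for multiplication by `x i`, exterior multiplication by the generator
`i`. -/
def homotopy [DecidableEq σ] (A : Type*) [CommRing A] [Module A N] (i : σ) :
    (l : List σ) → Chains N l →ₗ[A] Chains N l
  | [] => 0
  | j :: l =>
    if i = j then
      LinearMap.inr A (Chains N l) (Chains N l) ∘ₗ LinearMap.fst A (Chains N l) (Chains N l)
    else (homotopy A i l).prodMap (-homotopy A i l)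

section Homotopy

variable [DecidableEq σ]

theorem homotopy_pair_self (j : σ) {l : List σ} (α β : Chains N l) :
    homotopy A j (j :: l) (pair j α β) = pair j 0 α :=
  DFunLike.congr_fun (if_pos rfl : homotopy A j (j :: l) = _) (pair j α β)

theorem homotopy_pair_of_ne {i j : σ} (h : i ≠ j) {l : List σ} (α β : Chains N l) :
    homotopy A i (j :: l) (pair j α β) = pair j (homotopy A i l α) (-homotopy A i l β) :=
  DFunLike.congr_fun (if_neg h : homotopy A i (j :: l) = _) (pair j α β)

theorem bd_homotopy_add (x : σ → A) {i : σ} {l : List σ} (hi : i ∈ l) (z : Chains N l) :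
    bd x l (homotopy A i l z) + homotopy A i l (bd x l z) = x i • z := by
  induction l, z using Chains.induction with
  | single => exact absurd hi List.not_mem_nil
  | pair j l α β hα hβ =>
    rcases eq_or_ne i j with rfl | hij
    · simp only [homotopy_pair_self, bd_pair, pair_add, smul_pair, map_zero, zero_add,
        add_zero, neg_add_cancel_left]
    · have hi := (List.mem_cons.1 hi).resolve_left hij
      simp only [homotopy_pair_of_ne hij, bd_pair, pair_add, smul_pair, map_neg, map_add, map_smul,
        ← hα hi, ← hβ hi, neg_neg, smul_neg]
      congr 1
      abel

end Homotopy

end Complex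

section Pieces

variable {σ : Type w} {N N' N'' : Type*} [AddCommGroup N] [AddCommGroup N'] [AddCommGroup N'']
  {A A' : Type*} [CommRing A] [CommRing A'] [Module A N] [Module A' N']
  {P' : ℤ → AddSubgroup N'} {P : ℤ → AddSubgroup N} {e : σ → ℤ}

/-- The chains of homological degree `p` and internal degree `d`, when the generator `j` has
internal degree `e j`. -/
def piece (e : σ → ℤ) (P : ℤ → AddSubgroup N) : (l : List σ) → ℤ → ℤ → AddSubgroup (Chains N l)
  | [], p, d => if p = 0 then P d else ⊥
  | j :: l, p, d => (piece e P l p d).prod (piece e P l (p - 1) (d - e j))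

/-- Vanishing of Koszul homology in homological degree `p` and internal degree `d`. -/
def Acyclic (e : σ → ℤ) (P : ℤ → AddSubgroup N) (x : σ → A) (l : List σ) (p d : ℤ) : Prop :=
  ∀ z ∈ piece e P l p d, bd x l z = 0 → ∃ w ∈ piece e P l (p + 1) d, bd x l w = z

theorem single_mem_piece {p d : ℤ} {y : N} :
    single y ∈ piece e P [] p d ↔ y ∈ P d ∧ (p = 0 ∨ y = 0) := by
  have h : single y ∈ piece e P [] p d ↔ y ∈ if p = 0 then P d else ⊥ := Iff.rfl
  rw [h]
  split_ifs with hp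
  · simp only [hp, true_or, and_true]
  · rw [AddSubgroup.mem_bot, or_iff_right hp, iff_and_self]
    rintro rfl
    exact zero_mem _

theorem pair_mem_piece {j : σ} {l : List σ} {p d : ℤ} {α β : Chains N l} :
    pair j α β ∈ piece e P (j :: l) p d ↔
      α ∈ piece e P l p d ∧ β ∈ piece e P l (p - 1) (d - e j) := Iff.rfl

theorem map_mem_piece_add {φ : N →+ N'} {c : ℤ} (h : ∀ n, ∀ y ∈ P n, φ y ∈ P' (n + c))
    {l : List σ} {p d : ℤ} {z : Chains N l} (hz : z ∈ piece e P l p d) :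
    map φ l z ∈ piece e P' l p (d + c) := by
  induction l, z using Chains.induction generalizing p d with
  | single y =>
    rw [single_mem_piece] at hz
    refine single_mem_piece.2 ⟨h d y hz.1, hz.2.imp_right ?_⟩
    rintro rfl
    exact map_zero φ
  | pair j l α β hα hβ =>
    rw [pair_mem_piece] at hz
    refine pair_mem_piece.2 ⟨hα hz.1, ?_⟩
    rw [← sub_add_eq_add_sub]
    exact hβ hz.2

theorem map_mem_piece {φ : N →+ N'} (h : ∀ n, ∀ y ∈ P n, φ y ∈ P' n) {l : List σ} {p d : ℤ}
    {z : Chains N l} (hz : z ∈ piece e P l p d) : map φ l z ∈ piece e P' l p d := by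
  have := map_mem_piece_add (c := 0) (P' := P') (fun n y hy => by simpa using h n y hy) hz
  rwa [add_zero] at this

theorem exists_map_eq {φ : N' →+ N} (h : ∀ n, ∀ y ∈ P n, ∃ y' ∈ P' n, φ y' = y) {l : List σ}
    {p d : ℤ} {z : Chains N l} (hz : z ∈ piece e P l p d) :
    ∃ z' ∈ piece e P' l p d, map φ l z' = z := by
  induction l, z using Chains.induction generalizing p d with
  | single y =>
    rw [single_mem_piece] at hz
    obtain ⟨hy, rfl | rfl⟩ := hz
    · obtain ⟨y', hy', rfl⟩ := h d y hy
      exact ⟨single y', single_mem_piece.2 ⟨hy', Or.inl rfl⟩, rfl⟩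
    · exact ⟨0, zero_mem _, map_zero _⟩
  | pair j l α β hα hβ =>
    rw [pair_mem_piece] at hz
    obtain ⟨α', hα', rfl⟩ := hα hz.1
    obtain ⟨β', hβ', rfl⟩ := hβ hz.2
    exact ⟨pair j α' β', pair_mem_piece.2 ⟨hα', hβ'⟩, rfl⟩

/-- A chain of homological degree `p` and internal degree `d` has its coefficients in degrees at
least `d - p * c`, where `c` bounds the degrees of the generators. -/
theorem piece_le_piece {Q : ℤ → AddSubgroup N} {c : ℤ} (he : ∀ j, e j ≤ c) {l : List σ} {p d : ℤ}
    (h : ∀ n, d - p * c ≤ n → P n ≤ Q n) : piece e P l p d ≤ piece e Q l p d := by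
  intro z hz
  induction l, z using Chains.induction generalizing p d with
  | single y =>
    obtain ⟨hy, rfl | rfl⟩ := single_mem_piece.1 hz
    · exact single_mem_piece.2 ⟨h d (by simp) hy, Or.inl rfl⟩
    · exact zero_mem _
  | pair j l α β hα hβ =>
    rw [pair_mem_piece] at hz ⊢
    exact ⟨hα h hz.1, hβ (fun n hn => h n (by linarith [he j])) hz.2⟩

theorem mem_piece_inf_ker {φ : N →+ N'} {l : List σ} {p d : ℤ} {z : Chains N l}
    (hz : z ∈ piece e P l p d) (h0 : map φ l z = 0) :
    z ∈ piece e (fun n => P n ⊓ φ.ker) l p d := by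
  induction l, z using Chains.induction generalizing p d with
  | single y =>
    obtain ⟨hy, hp⟩ := single_mem_piece.1 hz
    exact single_mem_piece.2 ⟨⟨hy, h0⟩, hp⟩
  | pair j l α β hα hβ =>
    rw [pair_mem_piece] at hz ⊢
    rw [map_pair, ← pair_zero, pair_inj] at h0
    exact ⟨hα hz.1 h0.1, hβ hz.2 h0.2⟩

theorem eq_zero_of_mem_piece_of_neg {l : List σ} {p d : ℤ} (hp : p < 0) {z : Chains N l}
    (hz : z ∈ piece e P l p d) : z = 0 := by
  induction l, z using Chains.induction generalizing p d with
  | single y => exact (single_mem_piece.1 hz).2.resolve_left hp.ne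
  | pair j l α β hα hβ =>
    rw [pair_mem_piece] at hz
    rw [hα hp hz.1, hβ (by lia) hz.2, pair_zero]

theorem eq_zero_of_mem_piece_of_length_lt {l : List σ} {p d : ℤ} (hp : l.length < p)
    {z : Chains N l} (hz : z ∈ piece e P l p d) : z = 0 := by
  induction l, z using Chains.induction generalizing p d with
  | single y =>
    exact (single_mem_piece.1 hz).2.resolve_left (by rw [List.length_nil] at hp; lia)
  | pair j l α β hα hβ =>
    rw [pair_mem_piece] at hz
    rw [List.length_cons] at hp
    rw [hα (by lia) hz.1, hβ (by lia) hz.2, pair_zero]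

theorem eq_zero_of_mem_piece_of_lt {c m : ℤ} (he : ∀ j, c ≤ e j) (hP : ∀ n < m, P n = ⊥)
    {l : List σ} {p d : ℤ} (hd : d < m + p * c) {z : Chains N l} (hz : z ∈ piece e P l p d) :
    z = 0 := by
  induction l, z using Chains.induction generalizing p d with
  | single y =>
    obtain ⟨hy, rfl | rfl⟩ := single_mem_piece.1 hz
    · rw [zero_mul, add_zero] at hd
      rwa [hP d hd, AddSubgroup.mem_bot] at hy
    · rfl
  | pair j l α β hα hβ =>
    rw [pair_mem_piece] at hz
    rw [hα hd hz.1, hβ (by linarith [he j]) hz.2, pair_zero]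

section Graded

variable {x : σ → A} {𝒜 : ℤ → AddSubgroup A} [SetLike.GradedSMul 𝒜 P] {l : List σ} {p d : ℤ}

theorem smul_mem_piece {a : A} {c : ℤ} (ha : a ∈ 𝒜 c) {z : Chains N l}
    (hz : z ∈ piece e P l p d) : a • z ∈ piece e P l p (c + d) := by
  induction l, z using Chains.induction generalizing p d with
  | single y =>
    obtain ⟨hy, hp⟩ := single_mem_piece.1 hz
    refine single_mem_piece.2 ⟨SetLike.GradedSMul.smul_mem ha hy, hp.imp_right ?_⟩
    rintro rfl
    exact smul_zero a
  | pair j l α β hα hβ =>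
    rw [pair_mem_piece] at hz
    rw [smul_pair, pair_mem_piece, add_sub_assoc]
    exact ⟨hα hz.1, hβ hz.2⟩

theorem bd_mem_piece (hx : ∀ j, x j ∈ 𝒜 (e j)) {z : Chains N l} (hz : z ∈ piece e P l p d) :
    bd x l z ∈ piece e P l (p - 1) d := by
  induction l, z using Chains.induction generalizing p d with
  | single => exact zero_mem _
  | pair j l α β hα hβ =>
    rw [pair_mem_piece] at hz
    refine pair_mem_piece.2 ⟨add_mem (hα hz.1) ?_, neg_mem (hβ hz.2)⟩
    have := smul_mem_piece (hx j) hz.2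
    rwa [add_sub_cancel] at this

end Graded

theorem homotopy_mem_piece [DecidableEq σ] {i : σ} {l : List σ} {p d : ℤ} {z : Chains N l}
    (hz : z ∈ piece e P l p d) : homotopy A i l z ∈ piece e P l (p + 1) (d + e i) := by
  induction l, z using Chains.induction generalizing p d with
  | single => exact zero_mem _
  | pair j l α β hα hβ =>
    rw [pair_mem_piece] at hz
    rcases eq_or_ne i j with rfl | hij
    · rw [homotopy_pair_self, pair_mem_piece, add_sub_cancel_right, add_sub_cancel_right]
      exact ⟨zero_mem _, hz.1⟩
    · rw [homotopy_pair_of_ne hij, pair_mem_piece]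
      refine ⟨hα hz.1, neg_mem ?_⟩
      simpa only [sub_add_cancel, add_sub_cancel_right, sub_add_eq_add_sub] using hβ hz.2

theorem exists_bd_eq_smul {x : σ → A} {l : List σ} {i : σ} (hi : i ∈ l) {p d : ℤ}
    {z : Chains N l} (hz : z ∈ piece e P l p d) (h0 : bd x l z = 0) :
    ∃ w ∈ piece e P l (p + 1) (d + e i), bd x l w = x i • z := by
  classical
  refine ⟨homotopy A i l z, homotopy_mem_piece hz, ?_⟩
  rw [← bd_homotopy_add x hi, h0, map_zero, add_zero]

/-- The inclusion of the coefficients as the chains of homological degree zero. -/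
def incl : (l : List σ) → N →+ Chains N l
  | [] => AddMonoidHom.id N
  | _ :: l => (AddMonoidHom.inl (Chains N l) (Chains N l)).comp (incl l)

theorem incl_cons (j : σ) (l : List σ) (y : N) : incl (j :: l) y = pair j (incl l y) 0 := rfl

theorem map_incl (φ : N →+ N') (l : List σ) (y : N) : map φ l (incl l y) = incl l (φ y) := by
  induction l with
  | nil => rfl
  | cons j l ih => rw [incl_cons, incl_cons, map_pair, ih, map_zero]

theorem bd_incl (x : σ → A) (l : List σ) (y : N) : bd x l (incl l y) = 0 := by
  induction l with
  | nil => rfl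
  | cons j l ih => rw [incl_cons, bd_pair, ih, map_zero, smul_zero, neg_zero, add_zero, pair_zero]

theorem smul_incl (a : A) (l : List σ) (y : N) : a • incl l y = incl l (a • y) := by
  induction l with
  | nil => rfl
  | cons j l ih => rw [incl_cons, smul_pair, ih, smul_zero, incl_cons]

theorem incl_injective (l : List σ) : Function.Injective (incl (N := N) l) := by
  induction l with
  | nil => exact fun _ _ h => h
  | cons j l ih => exact fun y y' h => ih (pair_inj.1 h).1

theorem mem_piece_zero {l : List σ} {d : ℤ} {z : Chains N l} :
    z ∈ piece e P l 0 d ↔ ∃ y ∈ P d, incl l y = z := by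
  induction l, z using Chains.induction with
  | single y =>
    refine single_mem_piece.trans ⟨fun h => ⟨y, h.1, rfl⟩, ?_⟩
    rintro ⟨y', hy', h⟩
    obtain rfl : y' = y := h
    exact ⟨hy', Or.inl rfl⟩
  | pair j l α β hα hβ =>
    simp only [pair_mem_piece, incl_cons, pair_inj, hα]
    constructor
    · rintro ⟨⟨y, hy, rfl⟩, h⟩
      exact ⟨y, hy, rfl, (eq_zero_of_mem_piece_of_neg (by lia) h).symm⟩
    · rintro ⟨y, hy, rfl, rfl⟩
      exact ⟨⟨y, hy, rfl⟩, zero_mem _⟩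

section DegreeZero

open scoped Pointwise

theorem exists_bd_eq_incl {x : σ → A} {l : List σ} {d : ℤ} {w : Chains N l}
    (hw : w ∈ piece e P l 1 d) :
    ∃ y ∈ ⨆ i ∈ l, x i • P (d - e i), bd x l w = incl l y := by
  induction l, w using Chains.induction with
  | single => exact ⟨0, zero_mem _, rfl⟩
  | pair j l α β hα hβ =>
    obtain ⟨hα', hβ'⟩ := pair_mem_piece.1 hw
    obtain ⟨y, hy, h⟩ := hα hα'
    obtain ⟨y', hy', rfl⟩ := mem_piece_zero.1 (sub_self (1 : ℤ) ▸ hβ')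
    have hle : ⨆ i ∈ l, x i • P (d - e i) ≤ ⨆ i ∈ j :: l, x i • P (d - e i) :=
      biSup_mono fun i hi => List.mem_cons_of_mem j hi
    refine ⟨y + x j • y', add_mem (hle hy) ?_, ?_⟩
    · exact AddSubgroup.mem_iSup_of_mem j (AddSubgroup.mem_iSup_of_mem List.mem_cons_self
        (AddSubgroup.smul_mem_pointwise_smul _ _ _ hy'))
    · rw [bd_pair, h, bd_incl, neg_zero, smul_incl, incl_cons, map_add]

theorem exists_bd_eq_incl_iff {x : σ → A} {l : List σ} {d : ℤ} {y : N} :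
    (∃ w ∈ piece e P l 1 d, bd x l w = incl l y) ↔ y ∈ ⨆ i ∈ l, x i • P (d - e i) := by
  constructor
  · rintro ⟨w, hw, hwy⟩
    obtain ⟨y', hy', h⟩ := exists_bd_eq_incl (x := x) hw
    rwa [incl_injective l (hwy.symm.trans h)]
  · intro hy
    let T : AddSubgroup N := ((piece e P l 1 d).map (bd x l).toAddMonoidHom).comap (incl l)
    suffices h : ⨆ i ∈ l, x i • P (d - e i) ≤ T from h hy
    refine iSup₂_le fun i hi y hy => ?_
    obtain ⟨b, hb, rfl⟩ := (AddSubgroup.mem_smul_pointwise_iff_exists _ _ _).1 hy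
    obtain ⟨w, hw, h⟩ := exists_bd_eq_smul hi (mem_piece_zero.2 ⟨b, hb, rfl⟩) (bd_incl x l b)
    rw [zero_add, sub_add_cancel] at hw
    exact ⟨w, hw, h.trans (smul_incl _ _ _)⟩

theorem acyclic_zero_iff {x : σ → A} {l : List σ} {d : ℤ} :
    Acyclic e P x l 0 d ↔ P d ≤ ⨆ i ∈ l, x i • P (d - e i) := by
  refine ⟨fun h y hy => exists_bd_eq_incl_iff.1
    (h _ (mem_piece_zero.2 ⟨y, hy, rfl⟩) (bd_incl x l y)), fun h z hz _ => ?_⟩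
  obtain ⟨y, hy, rfl⟩ := mem_piece_zero.1 hz
  exact exists_bd_eq_incl_iff.2 (h hy)

end DegreeZero

theorem acyclic_of_neg {x : σ → A} {l : List σ} {p d : ℤ} (hp : p < 0) :
    Acyclic e P x l p d := fun z hz _ =>
  ⟨0, zero_mem _, by rw [eq_zero_of_mem_piece_of_neg hp hz, map_zero]⟩

theorem acyclic_of_length_lt {x : σ → A} {l : List σ} {p d : ℤ} (hp : l.length < p) :
    Acyclic e P x l p d := fun z hz _ =>
  ⟨0, zero_mem _, by rw [eq_zero_of_mem_piece_of_length_lt hp hz, map_zero]⟩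

theorem Acyclic.of_retract {x : σ → A} {x' : σ → A'} {l : List σ} {p d : ℤ}
    (h : Acyclic e P x l p d) {ι : N' →+ N} {π : N →+ N'} (hπι : ∀ y, π (ι y) = y)
    (hι : ∀ j y, ι (x' j • y) = x j • ι y) (hπ : ∀ j y, π (x j • y) = x' j • π y)
    (hPι : ∀ n, ∀ y ∈ P' n, ι y ∈ P n) (hPπ : ∀ n, ∀ y ∈ P n, π y ∈ P' n) :
    Acyclic e P' x' l p d := by
  intro z hz h0
  obtain ⟨w, hw, hwz⟩ := h (map ι l z) (map_mem_piece hPι hz)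
    (by rw [bd_map fun j _ => hι j, h0, map_zero])
  refine ⟨map π l w, map_mem_piece hPπ hw, ?_⟩
  rw [bd_map fun j _ => hπ j, hwz, map_map,
    show π.comp ι = AddMonoidHom.id N' from AddMonoidHom.ext hπι, map_id]

/-- The argument splits off one generator `j` at a time: the Koszul complex of `j :: l` is the cone
of the injective map `x j` on that of `l`, and `δ j` splits it. -/
theorem acyclic_of_leftInverse {x : σ → A} {𝒜 : ℤ → AddSubgroup A} [SetLike.GradedSMul 𝒜 P]
    (hx : ∀ j, x j ∈ 𝒜 (e j)) {δ : σ → N →+ N} (hδ : ∀ j y, δ j (x j • y) = y)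
    (hδx : ∀ i j, i ≠ j → ∀ y, δ j (x i • y) = x i • δ j y)
    (hPδ : ∀ j n, ∀ y ∈ P n, δ j y ∈ P (n - e j)) {l : List σ} (hl : l.Nodup) {p : ℤ}
    (hp : 0 < p) (d : ℤ) : Acyclic e P x l p d := by
  induction l with
  | nil =>
    exact fun z hz _ => ⟨0, zero_mem _, ((single_mem_piece.1 hz).2.resolve_left hp.ne').symm⟩
  | cons j l ih =>
    have hj : ∀ i ∈ l, i ≠ j := fun i hi h => (List.nodup_cons.1 hl).1 (h ▸ hi)
    intro z hz h0
    obtain ⟨α, β, rfl⟩ := exists_pair_eq z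
    rw [pair_mem_piece] at hz
    rw [bd_pair, ← pair_zero, pair_inj] at h0
    have hbδ : ∀ y, bd x l (map (δ j) l y) = map (δ j) l (bd x l y) :=
      bd_map fun i hi => hδx i j (hj i hi)
    have hδβ : map (δ j) l (x j • β) = β := by
      rw [← map_toAddMonoidHom, map_map, show (δ j).comp (DistribSMul.toAddMonoidHom N (x j)) =
        AddMonoidHom.id N from AddMonoidHom.ext (hδ j), map_id]
    have hα : bd x l α = -(x j • β) := eq_neg_of_add_eq_zero_left h0.1
    have hδα : map (δ j) l α ∈ piece e P l p (d - e j) :=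
      map_mem_piece_add (c := -e j) (fun n y hy => hPδ j n y hy) hz.1
    have hxδα := smul_mem_piece (hx j) hδα
    rw [add_sub_cancel] at hxδα
    obtain ⟨γ, hγ, hγα⟩ := ih hl.of_cons (α - x j • map (δ j) l α) (sub_mem hz.1 hxδα) (by
      rw [map_sub, map_smul, hbδ, hα, map_neg, hδβ, smul_neg, sub_self])
    refine ⟨pair j γ (map (δ j) l α), pair_mem_piece.2 ⟨hγ, by rwa [add_sub_cancel_right]⟩, ?_⟩
    rw [bd_pair, hγα, sub_add_cancel, hbδ, hα, map_neg, neg_neg, hδβ]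

/-- The relation `x i • y j = x j • y i` between two of the `y j` is a cycle in the lowest degree
that is possible for relations, hence not a boundary. -/
theorem length_le_one_of_acyclic {x : σ → A} {l : List σ} {y : σ → N} (hP : ∀ n < 1, P n = ⊥)
    (hy : ∀ j, y j ∈ P 1) (hy0 : ∀ j, y j ≠ 0) (hxy : ∀ i j, x i • y j = x j • y i)
    (h : Acyclic (fun _ => 1) P x l 1 2) : l.length ≤ 1 := by
  match l with
  | [] => exact Nat.zero_le 1
  | [_] => exact le_rfl
  | i :: j :: l =>
    exfalso
    obtain ⟨w, hw, hwz⟩ := h (pair i (pair j 0 (incl l (-y i))) (incl (j :: l) (y j)))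
      (pair_mem_piece.2 ⟨pair_mem_piece.2 ⟨zero_mem _, mem_piece_zero.2 ⟨_, neg_mem (hy i), rfl⟩⟩,
        mem_piece_zero.2 ⟨_, hy j, rfl⟩⟩) (by
      rw [bd_pair, bd_pair, bd_incl, bd_incl, map_zero, zero_add, smul_incl, smul_incl, neg_zero,
        ← incl_cons, ← map_add, smul_neg, hxy i j, neg_add_cancel, map_zero, neg_zero,
        pair_zero])
    rw [eq_zero_of_mem_piece_of_lt (fun _ => le_rfl) hP (by norm_num) hw, map_zero, ← pair_zero,
      pair_inj] at hwz
    exact hy0 j (incl_injective (j :: l) (hwz.2.symm.trans (map_zero _).symm))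

end Pieces

end Koszul

/-! ### Gradings by subgroups -/

section Gradings

theorem inf_iSup_le_of_iSupIndep {ι α : Type*} [CompleteLattice α] [IsModularLattice α]
    {P Q : ι → α} (hP : iSupIndep P) (hQP : Q ≤ P) (i : ι) : P i ⊓ ⨆ j, Q j ≤ Q i := by
  have hbot : P i ⊓ ⨆ (j) (_ : j ≠ i), Q j ≤ ⊥ :=
    (inf_le_inf_left _ (iSup₂_mono fun j _ => hQP j)).trans (hP i).le_bot
  calc P i ⊓ ⨆ j, Q j ≤ (Q i ⊔ ⨆ (j) (_ : j ≠ i), Q j) ⊓ P i := by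
        rw [inf_comm]
        refine inf_le_inf_right _ (iSup_le fun j => ?_)
        rcases eq_or_ne j i with rfl | hj
        · exact le_sup_left
        · exact le_sup_of_le_right (le_iSup₂_of_le j hj le_rfl)
    _ = Q i ⊔ (⨆ (j) (_ : j ≠ i), Q j) ⊓ P i := sup_inf_assoc_of_le _ (hQP i)
    _ ≤ Q i := sup_le le_rfl (by rw [inf_comm]; exact hbot.trans bot_le)

variable {J A N N' : Type*} [CommRing A] [AddCommGroup N] [AddCommGroup N'] [Module A N]
  [Module A N'] {𝒜 : ℤ → AddSubgroup A} {P : ℤ → AddSubgroup N} {P' : ℤ → AddSubgroup N'}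

theorem exists_mem_map_eq {φ : N →+ N'} (hP : ⨆ n, P n = ⊤) (hP' : iSupIndep P')
    (hφ : ∀ n, ∀ y ∈ P n, φ y ∈ P' n) {n : ℤ} {y : N} (hy : φ y ∈ P' n) :
    ∃ y' ∈ P n, φ y' = φ y := by
  refine inf_iSup_le_of_iSupIndep (Q := fun m => (P m).map φ) hP'
    (fun m => AddSubgroup.map_le_iff_le_comap.2 (hφ m)) n ⟨hy, ?_⟩
  rw [← AddSubgroup.map_iSup, hP]
  exact AddSubgroup.mem_map_of_mem φ (AddSubgroup.mem_top y)

theorem forall_mem_of_natCast {φ : N →+ N'} (hP : ∀ n < 0, P n = ⊥)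
    (hφ : ∀ n : ℕ, ∀ y ∈ P n, φ y ∈ P' n) (n : ℤ) (y : N) (hy : y ∈ P n) : φ y ∈ P' n := by
  rcases lt_or_ge n 0 with hn | hn
  · rw [hP n hn, AddSubgroup.mem_bot] at hy
    rw [hy, map_zero]
    exact zero_mem _
  · obtain ⟨n, rfl⟩ := Int.eq_ofNat_of_zero_le hn
    exact hφ n y hy

theorem iSupIndep_of_forall_map_mem {P' : J → ℤ → AddSubgroup N'} {ψ : J → N →+ N'}
    (hψ : ∀ y, (∀ j, ψ j y = 0) → y = 0) (hP' : ∀ j, iSupIndep (P' j))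
    (hψP : ∀ j n, ∀ y ∈ P n, ψ j y ∈ P' j n) : iSupIndep P := by
  refine fun n => disjoint_iff_inf_le.2 fun y hy => hψ y fun j => ?_
  refine (hP' j n).le_bot ⟨hψP j n y hy.1, ?_⟩
  suffices h : ⨆ (m) (_ : m ≠ n), P m ≤ (⨆ (m) (_ : m ≠ n), P' j m).comap (ψ j) from h hy.2
  exact iSup₂_le fun m hm y hy =>
    AddSubgroup.mem_iSup_of_mem m (AddSubgroup.mem_iSup_of_mem hm (hψP j m y hy))

/-- The grading of the direct sum of copies of `N` shifted by the degrees `deg j`. -/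
def freeGrading (P : ℤ → AddSubgroup N) (deg : J → ℤ) (n : ℤ) : AddSubgroup (J →₀ N) :=
  ⨅ j, (P (n - deg j)).comap (Finsupp.applyAddHom j)

variable {deg : J → ℤ} {n : ℤ}

theorem mem_freeGrading {g : J →₀ N} :
    g ∈ freeGrading P deg n ↔ ∀ j, g j ∈ P (n - deg j) := by
  rw [freeGrading, AddSubgroup.mem_iInf]
  rfl

theorem single_mem_freeGrading {j : J} {y : N} (hy : y ∈ P (n - deg j)) :
    Finsupp.single j y ∈ freeGrading P deg n := by
  classical
  refine mem_freeGrading.2 fun i => ?_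
  rw [Finsupp.single_apply]
  split_ifs with h
  · rwa [← h]
  · exact zero_mem _

instance freeGrading.gradedSMul [SetLike.GradedSMul 𝒜 P] :
    SetLike.GradedSMul 𝒜 (freeGrading P deg) where
  smul_mem {_ _ _ _} ha hg := mem_freeGrading.2 fun j => by
    rw [vadd_eq_add, add_sub_assoc]
    exact SetLike.GradedSMul.smul_mem ha (mem_freeGrading.1 hg j)

theorem freeGrading_eq_bot (hP : ∀ n < 0, P n = ⊥) (hdeg : ∀ j, 0 ≤ deg j) (hn : n < 0) :
    freeGrading P deg n = ⊥ := by
  refine (AddSubgroup.eq_bot_iff_forall _).2 fun g hg => Finsupp.ext fun j => ?_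
  have := mem_freeGrading.1 hg j
  rwa [hP _ (by linarith [hdeg j])] at this

theorem iSup_freeGrading (hP : ⨆ n, P n = ⊤) : ⨆ n, freeGrading P deg n = ⊤ := by
  refine eq_top_iff.2 fun g _ => ?_
  induction g using Finsupp.induction_linear with
  | zero => exact zero_mem _
  | add g g' hg hg' => exact add_mem (hg trivial) (hg' trivial)
  | single j y =>
    suffices h : ⨆ n, P n ≤ (⨆ n, freeGrading P deg n).comap (Finsupp.singleAddHom j) from
      h (hP ▸ AddSubgroup.mem_top y)
    refine iSup_le fun n y hy => AddSubgroup.mem_iSup_of_mem (n + deg j) ?_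
    exact single_mem_freeGrading (by rwa [add_sub_cancel_right])

theorem iSupIndep_freeGrading (hP : iSupIndep P) : iSupIndep (freeGrading P deg) :=
  iSupIndep_of_forall_map_mem (ψ := Finsupp.applyAddHom) (fun _ h => Finsupp.ext h)
    (fun j => hP.comp (sub_left_injective (b := deg j))) fun j _ _ hg => mem_freeGrading.1 hg j

theorem linearCombination_mem [SetLike.GradedSMul 𝒜 P] {z : J → N} (hz : ∀ j, z j ∈ P (deg j))
    {g : J →₀ A} (hg : g ∈ freeGrading 𝒜 deg n) : Finsupp.linearCombination A z g ∈ P n := by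
  rw [Finsupp.linearCombination_apply]
  refine sum_mem fun j _ => ?_
  have : g j • z j ∈ P ((n - deg j) + deg j) :=
    SetLike.GradedSMul.smul_mem (mem_freeGrading.1 hg j) (hz j)
  rwa [sub_add_cancel] at this

/-- The induced grading of a submodule. -/
def subGrading (P : ℤ → AddSubgroup N) (K : Submodule A N) (n : ℤ) : AddSubgroup K :=
  (P n).comap K.subtype.toAddMonoidHom

variable {K : Submodule A N}

theorem mem_subGrading {y : K} : y ∈ subGrading P K n ↔ (y : N) ∈ P n := Iff.rfl

instance subGrading.gradedSMul [SetLike.GradedSMul 𝒜 P] :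
    SetLike.GradedSMul 𝒜 (subGrading P K) where
  smul_mem {_ _ _ _} ha hy := mem_subGrading.2 (SetLike.GradedSMul.smul_mem ha hy)

theorem iSupIndep_subGrading (hP : iSupIndep P) : iSupIndep (subGrading P K) :=
  iSupIndep_of_forall_map_mem (ψ := fun _ : Unit => K.subtype.toAddMonoidHom)
    (fun _ hy => Subtype.ext (hy ())) (fun _ => hP) fun _ _ _ hy => hy

theorem iSup_subGrading_ker {φ : N →ₗ[A] N'} (hP : ⨆ n, P n = ⊤) (hP' : iSupIndep P')
    (hφ : ∀ n, ∀ y ∈ P n, φ y ∈ P' n) : ⨆ n, subGrading P (LinearMap.ker φ) n = ⊤ := by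
  classical
  refine eq_top_iff.2 fun y _ => ?_
  have hsum : ⨆ n, P n ≤ (DFinsupp.sumAddHom fun n => (P n).subtype).range :=
    iSup_le fun n z hz => ⟨DFinsupp.single n ⟨z, hz⟩, DFinsupp.sumAddHom_single _ _ _⟩
  obtain ⟨f, hf⟩ := hsum (hP ▸ AddSubgroup.mem_top (y : N))
  rw [DFinsupp.sumAddHom_apply] at hf
  let φP (n : ℤ) : P n →+ P' n :=
    (φ.toAddMonoidHom.comp (P n).subtype).codRestrict (P' n) fun z => hφ n z z.2
  have hφf : DFinsupp.mapRange.addMonoidHom φP f = 0 := by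
    refine hP'.dfinsuppSumAddHom_injective ?_
    rw [map_zero, ← LinearMap.mem_ker.1 y.2, ← hf, DFinsupp.sumAddHom_apply,
      DFinsupp.mapRange.addMonoidHom_apply, DFinsupp.sum_mapRange_index fun _ => rfl]
    exact (map_sum φ _ _).symm
  have hker (n : ℤ) : (f n : N) ∈ LinearMap.ker φ :=
    congrArg Subtype.val (DFunLike.congr_fun hφf n)
  have hy : y = ∑ n ∈ f.support, ⟨f n, hker n⟩ := by
    rw [Subtype.ext_iff, ← hf]
    exact (map_sum (LinearMap.ker φ).subtype (fun n => ⟨f n, hker n⟩) f.support).symm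
  rw [hy]
  exact sum_mem fun n _ => AddSubgroup.mem_iSup_of_mem n (f n).2

theorem subGrading_eq_bot (h : P n = ⊥) : subGrading P K n = ⊥ :=
  (AddSubgroup.eq_bot_iff_forall _).2 fun y hy => Subtype.ext (by
    rwa [mem_subGrading, h] at hy)

end Gradings

namespace Koszul

section Free

variable {σ : Type w} {J A N : Type*} [CommRing A] [AddCommGroup N] [Module A N]
  {e : σ → ℤ} {P : ℤ → AddSubgroup N} {deg : J → ℤ} {x : σ → A} {l : List σ} {p d : ℤ}

theorem exists_forall_sum_map_single_eq (z : Chains (J →₀ N) l) :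
    ∃ s : Finset J, ∀ t, s ⊆ t →
      ∑ j ∈ t, map (Finsupp.singleAddHom j) l (map (Finsupp.applyAddHom j) l z) = z := by
  classical
  induction l, z using Chains.induction with
  | single g =>
    refine ⟨g.support, fun t ht => ?_⟩
    exact (Finsupp.sum_of_support_subset g ht _ fun j _ => Finsupp.single_zero j).symm.trans
      g.sum_single
  | pair j l α β hα hβ =>
    obtain ⟨s, hs⟩ := hα
    obtain ⟨s', hs'⟩ := hβ
    refine ⟨s ∪ s', fun t ht => ?_⟩
    simp only [map_pair, sum_pair, hs t (Finset.union_subset_left ht),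
      hs' t (Finset.union_subset_right ht)]

theorem exists_sum_map_single_eq (z : Chains (J →₀ N) l) :
    ∃ s : Finset J,
      ∑ j ∈ s, map (Finsupp.singleAddHom j) l (map (Finsupp.applyAddHom j) l z) = z :=
  (exists_forall_sum_map_single_eq z).imp fun s hs => hs s subset_rfl

theorem map_apply_mem_piece {z : Chains (J →₀ N) l} (hz : z ∈ piece e (freeGrading P deg) l p d)
    (j : J) : map (Finsupp.applyAddHom j) l z ∈ piece e P l p (d - deg j) :=
  map_mem_piece_add (c := -deg j) (fun _ _ hg => mem_freeGrading.1 hg j) hz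

theorem bd_map_apply (j : J) (z : Chains (J →₀ N) l) :
    bd x l (map (Finsupp.applyAddHom j) l z) = map (Finsupp.applyAddHom j) l (bd x l z) :=
  bd_map (fun _ _ _ => rfl) z

theorem acyclic_free (h : ∀ j, Acyclic e P x l p (d - deg j)) :
    Acyclic e (freeGrading P deg) x l p d := by
  intro z hz h0
  choose w hw hwz using fun j =>
    h j _ (map_apply_mem_piece hz j) (by rw [bd_map_apply, h0, map_zero])
  obtain ⟨s, hs⟩ := exists_sum_map_single_eq z
  refine ⟨∑ j ∈ s, map (Finsupp.singleAddHom j) l (w j), sum_mem fun j _ => ?_, ?_⟩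
  · have hmem := map_mem_piece_add (P' := freeGrading P deg) (φ := Finsupp.singleAddHom j)
      (fun n y hy => single_mem_freeGrading (by rwa [add_sub_cancel_right])) (hw j)
    rwa [sub_add_cancel] at hmem
  · rw [← hs, map_sum]
    refine Finset.sum_congr rfl fun j _ => ?_
    rw [← hwz, bd_map fun i _ y => (Finsupp.smul_single (x i) j y).symm]

/-- Multiplication by `f j` is null-homotopic on the Koszul complex of `f`, so a combination of
cycles with coefficients in the sequence is a boundary. -/
theorem exists_bd_eq_map_linearCombination {e : J → ℤ} {𝒜 : ℤ → AddSubgroup A} {f : J → A}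
    {l : List J} (hl : ∀ j, j ∈ l) {g : Chains (J →₀ A) l}
    (hg : g ∈ piece e (freeGrading 𝒜 e) l p d) (h0 : bd f l g = 0) :
    ∃ w ∈ piece e 𝒜 l (p + 1) d,
      bd f l w = map (Finsupp.linearCombination A f).toAddMonoidHom l g := by
  choose w hw hwz using fun j => exists_bd_eq_smul (x := f) (hl j) (map_apply_mem_piece hg j)
    (by rw [bd_map_apply, h0, map_zero])
  simp only [sub_add_cancel] at hw
  obtain ⟨s, hs⟩ := exists_sum_map_single_eq g
  refine ⟨∑ j ∈ s, w j, sum_mem fun j _ => hw j, ?_⟩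
  conv_rhs => rw [← hs]
  rw [map_sum, map_sum]
  refine Finset.sum_congr rfl fun j _ => ?_
  rw [hwz, ← map_toAddMonoidHom (f j), map_map, map_map, map_map]
  refine congrArg (fun χ => map χ l g) (AddMonoidHom.ext fun c => ?_)
  exact (mul_comm (f j) (c j)).trans (Finsupp.linearCombination_single A (c j) j).symm

end Free

section Kernel

variable {σ : Type w} {A N N' : Type*} [CommRing A] [AddCommGroup N] [AddCommGroup N']
  [Module A N] [Module A N'] {e : σ → ℤ} {𝒜 : ℤ → AddSubgroup A} {P : ℤ → AddSubgroup N}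
  {P' : ℤ → AddSubgroup N'} {φ : N →ₗ[A] N'} {x : σ → A} {l : List σ} {p d : ℤ}

theorem exists_map_subtype_eq {z : Chains N l} (hz : z ∈ piece e P l p d)
    (h0 : map φ.toAddMonoidHom l z = 0) :
    ∃ u ∈ piece e (subGrading P (LinearMap.ker φ)) l p d,
      map (LinearMap.ker φ).subtype.toAddMonoidHom l u = z :=
  exists_map_eq (fun _ y (hy : y ∈ P _ ⊓ _) => ⟨⟨y, hy.2⟩, hy.1, rfl⟩) (mem_piece_inf_ker hz h0)

theorem bd_map_linear (φ : N →ₗ[A] N') (z : Chains N l) :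
    bd x l (map φ.toAddMonoidHom l z) = map φ.toAddMonoidHom l (bd x l z) :=
  bd_map (fun j _ => φ.map_smul (x j)) z

theorem map_map_ker (u : Chains (LinearMap.ker φ) l) :
    map φ.toAddMonoidHom l (map (LinearMap.ker φ).subtype.toAddMonoidHom l u) = 0 := by
  rw [map_map, ← map_zero_hom l u]
  exact congrArg (fun χ => map χ l u) (AddMonoidHom.ext fun y => y.2)

/-- In homological degree `p` and internal degree `d`, the Koszul homology of `ker φ` injects into
that of the domain of `φ`. -/
def KerInjective (e : σ → ℤ) (P : ℤ → AddSubgroup N) (φ : N →ₗ[A] N') (x : σ → A) (l : List σ)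
    (p d : ℤ) : Prop :=
  ∀ u ∈ piece e (subGrading P (LinearMap.ker φ)) l p d, ∀ w ∈ piece e P l (p + 1) d,
    bd x l w = map (LinearMap.ker φ).subtype.toAddMonoidHom l u →
      ∃ v ∈ piece e (subGrading P (LinearMap.ker φ)) l (p + 1) d, bd x l v = u

theorem kerInjective_of_acyclic_ker (h : Acyclic e (subGrading P (LinearMap.ker φ)) x l p d) :
    KerInjective e P φ x l p d := by
  refine fun u hu w _ hwu => h u hu ?_
  apply map_injective (φ := (LinearMap.ker φ).subtype.toAddMonoidHom) Subtype.val_injective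
  rw [← bd_map_linear, ← hwu, bd_bd, map_zero]

theorem acyclic_ker (hN : Acyclic e P x l p d) (h : KerInjective e P φ x l p d) :
    Acyclic e (subGrading P (LinearMap.ker φ)) x l p d := by
  intro u hu h0
  obtain ⟨w, hw, hwu⟩ := hN _ (map_mem_piece (fun _ _ hy => hy) hu) (by
    rw [bd_map_linear, h0, map_zero])
  exact h u hu w hw hwu

variable [SetLike.GradedSMul 𝒜 P]

theorem kerInjective_of_acyclic_codomain
    (hx : ∀ j, x j ∈ 𝒜 (e j)) (hφ : ∀ n, (P n).map φ.toAddMonoidHom = P' n)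
    (h : Acyclic e P' x l (p + 1) d) : KerInjective e P φ x l p d := by
  intro u _ w hw hwu
  obtain ⟨v, hv, hvw⟩ := h _ (map_mem_piece (fun n y hy => (hφ n).le ⟨y, hy, rfl⟩) hw) (by
    rw [bd_map_linear, hwu, map_map_ker])
  obtain ⟨w', hw', rfl⟩ := exists_map_eq (fun n y hy => (hφ n).ge hy) hv
  rw [bd_map_linear] at hvw
  have hbd := bd_mem_piece (p := p + 1 + 1) hx hw'
  rw [add_sub_cancel_right] at hbd
  obtain ⟨v', hv', hv'w⟩ := exists_map_subtype_eq (φ := φ) (sub_mem hw hbd) (by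
    rw [map_sub, hvw, sub_self])
  refine ⟨v', hv', ?_⟩
  apply map_injective (φ := (LinearMap.ker φ).subtype.toAddMonoidHom) Subtype.val_injective
  rw [← bd_map_linear, hv'w, map_sub, bd_bd, sub_zero, hwu]

theorem KerInjective.exists_cycle_lift
    (hx : ∀ j, x j ∈ 𝒜 (e j)) (hφ : ∀ n, (P n).map φ.toAddMonoidHom = P' n)
    (h : KerInjective e P φ x l (p - 1) d) {z : Chains N' l} (hz : z ∈ piece e P' l p d)
    (h0 : bd x l z = 0) :
    ∃ g ∈ piece e P l p d, bd x l g = 0 ∧ map φ.toAddMonoidHom l g = z := by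
  obtain ⟨g, hg, rfl⟩ := exists_map_eq (fun n y hy => (hφ n).ge hy) hz
  rw [bd_map_linear] at h0
  obtain ⟨u, hu, hug⟩ := exists_map_subtype_eq (bd_mem_piece hx hg) h0
  obtain ⟨v, hv, rfl⟩ := h u hu g (by rwa [sub_add_cancel]) hug.symm
  rw [sub_add_cancel] at hv
  refine ⟨g - map _ l v, sub_mem hg (map_mem_piece (fun _ _ hy => hy) hv), ?_, ?_⟩
  · rw [map_sub, ← hug, bd_map_linear, sub_self]
  · rw [map_sub, map_map_ker, sub_zero]

theorem KerInjective.acyclic_codomain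
    (hx : ∀ j, x j ∈ 𝒜 (e j)) (hφ : ∀ n, (P n).map φ.toAddMonoidHom = P' n)
    (h : KerInjective e P φ x l (p - 1) d) (hN : Acyclic e P x l p d) : Acyclic e P' x l p d := by
  intro z hz h0
  obtain ⟨g, hg, hg0, rfl⟩ := h.exists_cycle_lift hx hφ hz h0
  obtain ⟨w, hw, rfl⟩ := hN g hg hg0
  exact ⟨map _ l w, map_mem_piece (fun n y hy => (hφ n).le ⟨y, hy, rfl⟩) hw, bd_map_linear φ w⟩

end Kernel

end Koszul

/-! ### Change of coefficients and of the sequence -/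

namespace Koszul

variable {σ : Type*} {A : Type u} [CommRing A] {𝒜 : ℤ → AddSubgroup A} {e : σ → ℤ} {x : σ → A}
  {l : List σ}

/-- The Koszul complex of the homogeneous sequence `x` is a resolution of `A/A₊`, where `𝒜` is a
grading of `A` in nonnegative degrees. -/
structure IsKoszulResolution (𝒜 : ℤ → AddSubgroup A) (e : σ → ℤ) (x : σ → A) (l : List σ) :
    Prop where
  eq_bot : ∀ n < 0, 𝒜 n = ⊥
  mem : ∀ j, x j ∈ 𝒜 (e j)
  pos : ∀ j, 0 < e j
  acyclic : ∀ p d, 0 < p ∨ 0 < d → Acyclic e 𝒜 x l p d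

variable [SetLike.GradedMonoid 𝒜]

section Nakayama

variable {N : Type*} [AddCommGroup N] [Module A N] {P : ℤ → AddSubgroup N} {t : ℤ}

/-- Graded Nakayama: Koszul homology in homological degree zero bounds the degrees of generators. -/
theorem IsKoszulResolution.le_map_linearCombination {J : Type*} (hx : IsKoszulResolution 𝒜 e x l)
    (hP : ∀ n < 0, P n = ⊥) (h : ∀ d, t < d → Acyclic e P x l 0 d) {deg : J → ℤ} {z : J → N}
    (hz : ∀ n ≤ t, P n ≤
      (freeGrading 𝒜 deg n).map (Finsupp.linearCombination A z).toAddMonoidHom) (n : ℤ) :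
    P n ≤ (freeGrading 𝒜 deg n).map (Finsupp.linearCombination A z).toAddMonoidHom := by
  induction hm : (n + 1).toNat using Nat.strong_induction_on generalizing n with
  | _ m ih =>
  rcases lt_or_ge n 0 with h0 | h0
  · exact (hP n h0).trans_le bot_le
  rcases le_or_gt n t with hnt | hnt
  · exact hz n hnt
  refine (acyclic_zero_iff.1 (h n hnt)).trans (iSup₂_le fun i _ => ?_)
  rintro _ ⟨y, hy, rfl⟩
  obtain ⟨g, hg, rfl⟩ := ih (n - e i + 1).toNat (by have := hx.pos i; lia) (n - e i) rfl hy
  have hmem : x i • g ∈ freeGrading 𝒜 deg (e i + (n - e i)) :=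
    SetLike.GradedSMul.smul_mem (hx.mem i) hg
  rw [add_sub_cancel] at hmem
  exact ⟨x i • g, hmem, (Finsupp.linearCombination A z).map_smul _ _⟩

theorem IsKoszulResolution.exists_graded_cover {N : Type u} [AddCommGroup N] [Module A N]
    {P : ℤ → AddSubgroup N} [SetLike.GradedSMul 𝒜 P] (hx : IsKoszulResolution 𝒜 e x l)
    (hP : ∀ n < 0, P n = ⊥) (h : ∀ d, t < d → Acyclic e P x l 0 d) :
    ∃ (J : Type u) (deg : J → ℤ) (φ : (J →₀ A) →ₗ[A] N), (∀ j, 0 ≤ deg j) ∧ (∀ j, deg j ≤ t) ∧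
      ∀ n, (freeGrading 𝒜 deg n).map φ.toAddMonoidHom = P n := by
  let J := {y : ℤ × N // 0 ≤ y.1 ∧ y.1 ≤ t ∧ y.2 ∈ P y.1}
  refine ⟨J, fun j => j.1.1, Finsupp.linearCombination A fun j : J => j.1.2, fun j => j.2.1,
    fun j => j.2.2.1, fun n => le_antisymm ?_ (hx.le_map_linearCombination hP h ?_ n)⟩
  · rintro _ ⟨g, hg, rfl⟩
    exact linearCombination_mem (fun j : J => j.2.2.2) hg
  · intro m hm y hy
    rcases lt_or_ge m 0 with h0 | h0
    · rw [hP m h0] at hy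
      exact ⟨0, zero_mem _, (map_zero _).trans hy.symm⟩
    · let j : J := ⟨(m, y), h0, hm, hy⟩
      have hone : (1 : A) ∈ 𝒜 (m - j.1.1) := by
        rw [sub_self]
        exact SetLike.GradedOne.one_mem
      exact ⟨Finsupp.single j 1, single_mem_freeGrading hone,
        (Finsupp.linearCombination_single A 1 j).trans (one_smul A y)⟩

theorem IsKoszulResolution.acyclic_ker {J : Type*} [SetLike.GradedSMul 𝒜 P]
    (hx : IsKoszulResolution 𝒜 e x l) {t : ℕ → ℤ} (ht : Monotone t) {deg : J → ℤ}
    (hdeg : ∀ j, deg j ≤ t 0) {φ : (J →₀ A) →ₗ[A] N}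
    (hφ : ∀ n, (freeGrading 𝒜 deg n).map φ.toAddMonoidHom = P n)
    (hN : ∀ (s : ℕ) d, t s < d → Acyclic e P x l s d) (s : ℕ) {d : ℤ} (hd : t (s + 1) < d) :
    Acyclic e (subGrading (freeGrading 𝒜 deg) (LinearMap.ker φ)) x l s d := by
  refine Koszul.acyclic_ker (acyclic_free fun j => hx.acyclic s _ (Or.inr ?_))
    (kerInjective_of_acyclic_codomain hx.mem hφ (by exact_mod_cast hN (s + 1) d hd))
  linarith [hdeg j, ht (Nat.zero_le (s + 1))]

end Nakayama

/-- Dimension shifting along a cover of `N` by a free module in degrees at most `t 0`. -/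
theorem IsKoszulResolution.acyclic_of_syzygies {τ : Type*} {f : τ → A} {e' : τ → ℤ} {l' : List τ}
    (hx : IsKoszulResolution 𝒜 e x l) (hf : ∀ j, f j ∈ 𝒜 (e' j)) (p : ℕ) {N : Type u}
    [AddCommGroup N] [Module A N] {P : ℤ → AddSubgroup N} [SetLike.GradedSMul 𝒜 P]
    (hP : ∀ n < 0, P n = ⊥) {t : ℕ → ℤ} (ht : Monotone t)
    (hN : ∀ (s : ℕ) d, t s < d → Acyclic e P x l s d) {d : ℤ}
    (hd : ∀ q ≤ p, ∀ c ≤ t (p - q), Acyclic e' 𝒜 f l' q (d - c)) : Acyclic e' P f l' p d := by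
  induction p generalizing N t with
  | zero =>
    obtain ⟨J, deg, φ, -, hdeg, hφ⟩ := hx.exists_graded_cover hP (hN 0)
    exact (kerInjective_of_acyclic_ker (acyclic_of_neg (by simp))).acyclic_codomain hf hφ
      (acyclic_free fun j => hd 0 le_rfl _ (hdeg j))
  | succ p ih =>
    obtain ⟨J, deg, φ, hdeg0, hdeg, hφ⟩ := hx.exists_graded_cover hP (hN 0)
    have hker : Acyclic e' (subGrading (freeGrading 𝒜 deg) (LinearMap.ker φ)) f l' p d :=
      ih (fun n hn => subGrading_eq_bot (freeGrading_eq_bot hx.eq_bot hdeg0 hn))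
        (fun a b hab => ht (Nat.succ_le_succ hab))
        (fun s d => hx.acyclic_ker ht hdeg hφ hN s) fun q hq c hc =>
          hd q (Nat.le_succ_of_le hq) c (by rwa [Nat.succ_sub hq])
    refine (kerInjective_of_acyclic_ker ?_).acyclic_codomain hf hφ
      (acyclic_free fun j => hd (p + 1) le_rfl _ (by simpa using hdeg j))
    rwa [Nat.cast_succ, add_sub_cancel_right]

end Koszul

theorem map_rangeRestrict_eq {A J : Type*} [CommRing A] {𝒜 : ℤ → AddSubgroup A}
    [SetLike.GradedMonoid 𝒜] (h𝒜 : iSupIndep 𝒜) (h𝒜' : ⨆ n, 𝒜 n = ⊤) {deg : J → ℤ} {f : J → A}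
    (hf : ∀ j, f j ∈ 𝒜 (deg j)) (n : ℤ) :
    (freeGrading 𝒜 deg n).map (Finsupp.linearCombination A f).rangeRestrict.toAddMonoidHom =
      subGrading 𝒜 (LinearMap.range (Finsupp.linearCombination A f)) n := by
  apply le_antisymm
  · rintro _ ⟨g, hg, rfl⟩
    exact linearCombination_mem hf hg
  · rintro ⟨_, g, rfl⟩ hy
    obtain ⟨g', hg', h⟩ := exists_mem_map_eq (P := freeGrading 𝒜 deg)
      (φ := (Finsupp.linearCombination A f).toAddMonoidHom) (iSup_freeGrading h𝒜') h𝒜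
      (fun n g hg => linearCombination_mem hf hg) hy
    exact ⟨g', hg', Subtype.ext h⟩

namespace Koszul

/-- A cycle of high degree has its coefficients in the ideal `I` generated by `f`. It lifts to a
cycle with coefficients in the free module that covers `I`, since by induction on the homological
degree the obstruction vanishes. Such a cycle maps to a boundary. -/
theorem IsKoszulResolution.acyclic_of_generators {σ : Type*} {A : Type u} [CommRing A]
    {𝒜 : ℤ → AddSubgroup A} [SetLike.GradedMonoid 𝒜] {e : σ → ℤ} {x : σ → A} {l : List σ}
    (hx : IsKoszulResolution 𝒜 e x l) (h𝒜 : iSupIndep 𝒜) (h𝒜' : ⨆ n, 𝒜 n = ⊤)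
    {J : Type} {f : J → A} {e' : J → ℤ} {l' : List J} (hl' : ∀ j, j ∈ l')
    (hf : ∀ j, f j ∈ 𝒜 (e' j)) (he' : ∀ j, 0 ≤ e' j) {τ : ℤ} (heτ : ∀ j, e' j ≤ τ)
    {I : Ideal A} (hfI : LinearMap.range (Finsupp.linearCombination A f) = I)
    (hτ : ∀ n, τ ≤ n → 𝒜 n ≤ I.toAddSubgroup) {t : ℕ → ℤ} (ht : Monotone t) (ht0 : τ ≤ t 0)
    (hI : ∀ (s : ℕ) d, t s < d → Acyclic e (subGrading 𝒜 I) x l s d)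
    {β : ℕ → ℤ} (hβ : ∀ q : ℕ, (q + 1) * τ ≤ β q) (hβt : ∀ p q, p < q → β p + t (q - p) ≤ β q)
    (q : ℕ) {d : ℤ} (hd : β q ≤ d) : Acyclic e' 𝒜 f l' q d := by
  subst hfI
  induction q using Nat.strong_induction_on generalizing d with
  | _ q ih =>
  intro z hz h0
  set φ := (Finsupp.linearCombination A f).rangeRestrict
  let I := LinearMap.range (Finsupp.linearCombination A f)
  have hφ := map_rangeRestrict_eq h𝒜 h𝒜' hf
  have hcoeff : ∀ n, d - q * τ ≤ n → 𝒜 n ≤ 𝒜 n ⊓ I.toAddSubgroup :=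
    fun n hn => le_inf le_rfl (hτ n (by linarith [hβ q]))
  obtain ⟨y, hy, rfl⟩ := exists_map_eq (P' := subGrading 𝒜 I) (φ := I.subtype.toAddMonoidHom)
    (fun n y (hy : y ∈ 𝒜 n ⊓ I.toAddSubgroup) => ⟨⟨y, hy.2⟩, hy.1, rfl⟩)
    (piece_le_piece heτ hcoeff hz)
  have hy0 : bd f l' y = 0 := map_injective (φ := I.subtype.toAddMonoidHom)
    Subtype.val_injective l' (by rw [← bd_map_linear, h0, map_zero])
  have hker : Acyclic e' (subGrading (freeGrading 𝒜 e') (LinearMap.ker φ)) f l' (q - 1) d := by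
    rcases q with - | q
    · exact acyclic_of_neg (by simp)
    rw [Nat.cast_succ, add_sub_cancel_right]
    refine hx.acyclic_of_syzygies hf q (t := fun s => t (s + 1))
      (fun n hn => subGrading_eq_bot (freeGrading_eq_bot hx.eq_bot he' hn))
      (fun a b hab => ht (Nat.succ_le_succ hab))
      (fun s d => hx.acyclic_ker ht (fun j => (heτ j).trans ht0) hφ hI s) fun p hp c hc => ?_
    have hpq := hβt p (q + 1) (Nat.lt_succ_of_le hp)
    rw [Nat.succ_sub hp] at hpq
    exact ih p (Nat.lt_succ_of_le hp) (by linarith)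
  obtain ⟨g, hg, hg0, rfl⟩ := (kerInjective_of_acyclic_ker hker).exists_cycle_lift hf hφ hy hy0
  obtain ⟨w, hw, hwg⟩ := exists_bd_eq_map_linearCombination hl' hg hg0
  refine ⟨w, hw, ?_⟩
  rw [hwg, map_map]
  rfl

theorem IsKoszulResolution.acyclic_subGrading {σ : Type*} {A : Type u} [CommRing A]
    {𝒜 : ℤ → AddSubgroup A} {e : σ → ℤ} {x : σ → A} {l : List σ}
    (hx : IsKoszulResolution 𝒜 e x l) (he : ∀ j, e j ≤ 1) {I : Ideal A} {τ : ℤ} (hτ0 : 0 ≤ τ)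
    (hτ : ∀ n, τ ≤ n → 𝒜 n ≤ I.toAddSubgroup) (s : ℕ) (d : ℤ) (hd : τ + s < d) :
    Acyclic e (subGrading 𝒜 I) x l s d := by
  intro z hz h0
  obtain ⟨w, hw, hwz⟩ := hx.acyclic s d (Or.inr (by lia))
    (map I.subtype.toAddMonoidHom l z) (map_mem_piece (fun _ _ hy => hy) hz)
    (by rw [bd_map_linear, h0, map_zero])
  have hcoeff : ∀ n, d - (s + 1) * 1 ≤ n → 𝒜 n ≤ 𝒜 n ⊓ I.toAddSubgroup :=
    fun n hn => le_inf le_rfl (hτ n (by lia))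
  obtain ⟨y, hy, rfl⟩ := exists_map_eq (P' := subGrading 𝒜 I) (φ := I.subtype.toAddMonoidHom)
    (fun n y (hy : y ∈ 𝒜 n ⊓ I.toAddSubgroup) => ⟨⟨y, hy.2⟩, hy.1, rfl⟩)
    (piece_le_piece he hcoeff hw)
  refine ⟨y, hy, map_injective (φ := I.subtype.toAddMonoidHom) Subtype.val_injective l ?_⟩
  rw [← bd_map_linear, hwz]

end Koszul

/-! ### Polynomial rings -/

section IntGrading

variable {k : Type*} [Field k] {M : Type*} [AddCommGroup M] [Module k M] {ℳ : ℕ → Submodule k M}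

/-- A grading by the natural numbers, extended by zero to the integers. -/
def intGrading (ℳ : ℕ → Submodule k M) : ℤ → AddSubgroup M
  | .ofNat n => (ℳ n).toAddSubgroup
  | .negSucc _ => ⊥

theorem mem_intGrading_natCast {n : ℕ} {y : M} : y ∈ intGrading ℳ n ↔ y ∈ ℳ n := Iff.rfl

theorem intGrading_eq_bot : ∀ n < 0, intGrading ℳ n = ⊥
  | .negSucc _, _ => rfl

theorem iSupIndep_intGrading (h : DirectSum.IsInternal ℳ) : iSupIndep (intGrading ℳ) := by
  have hℕ : iSupIndep fun n => (ℳ n).toAddSubgroup :=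
    DirectSum.IsInternal.addSubgroup_iSupIndep (A := fun n => (ℳ n).toAddSubgroup) h
  have hnat (m : {m // intGrading ℳ m ≠ ⊥}) : (m.1.toNat : ℤ) = m.1 :=
    Int.toNat_of_nonneg (not_lt.1 fun hm => m.2 (intGrading_eq_bot _ hm))
  rw [← iSupIndep_ne_bot]
  convert hℕ.comp (f := fun m : {m // intGrading ℳ m ≠ ⊥} => m.1.toNat)
    fun a b hab => Subtype.ext (by rw [← hnat a, ← hnat b]; exact congrArg _ hab) with m
  rw [← hnat m]
  rfl

theorem iSup_intGrading (h : ⨆ n, ℳ n = ⊤) : ⨆ n, intGrading ℳ n = ⊤ := by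
  refine eq_top_iff.2 fun y _ => ?_
  have hy : y ∈ ⨆ n, ℳ n := h ▸ Submodule.mem_top
  exact Submodule.iSup_induction ℳ (motive := (· ∈ ⨆ n, intGrading ℳ n)) hy
    (fun n _ hn => AddSubgroup.mem_iSup_of_mem (n : ℤ) hn)
    (zero_mem _) fun _ _ => add_mem

variable {A : Type*} [CommRing A] [Algebra k A] {𝒜 : ℕ → Submodule k A}

instance intGrading.gradedSMul [Module A M] [SetLike.GradedSMul 𝒜 ℳ] :
    SetLike.GradedSMul (intGrading 𝒜) (intGrading ℳ) where
  smul_mem {i j a y} ha hy := by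
    match i, j with
    | .ofNat i, .ofNat j => exact SetLike.GradedSMul.smul_mem (A := 𝒜) (B := ℳ) ha hy
    | .negSucc i, _ =>
      rw [AddSubgroup.mem_bot.1 ha, zero_smul]
      exact zero_mem _
    | _, .negSucc j =>
      rw [AddSubgroup.mem_bot.1 hy, smul_zero]
      exact zero_mem _

instance intGrading.gradedMonoid [SetLike.GradedMonoid 𝒜] :
    SetLike.GradedMonoid (intGrading 𝒜) where
  one_mem := SetLike.GradedOne.one_mem (A := 𝒜)
  mul_mem _ _ _ _ ha hb := intGrading.gradedSMul.smul_mem ha hb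

theorem mem_freePiece_iff {J : Type*} {deg : J → ℕ} {n : ℕ} {g : J →₀ A} :
    g ∈ freePiece 𝒜 deg n ↔ g ∈ freeGrading (intGrading 𝒜) (fun j => (deg j : ℤ)) n := by
  refine (forall_congr' fun j => ?_).trans mem_freeGrading.symm
  split_ifs with h
  · rw [← Nat.cast_sub h, mem_intGrading_natCast]
  · rw [intGrading_eq_bot _ (by lia), Submodule.mem_bot, AddSubgroup.mem_bot]

end IntGrading

section Polynomial

open MvPolynomial Koszul Pointwise

variable {σ : Type*} {k : Type*} [Field k]

theorem isInternal_weightedHomogeneousSubmodule (e : σ → ℕ) :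
    DirectSum.IsInternal (weightedHomogeneousSubmodule k e) :=
  letI := weightedDecomposition k e
  DirectSum.Decomposition.isInternal _

/-- Division by a variable, discarding the remainder. -/
def divX (j : σ) : MvPolynomial σ k →+ MvPolynomial σ k where
  toFun p := p.divMonomial (Finsupp.single j 1)
  map_zero' := zero_divMonomial _
  map_add' p q := add_divMonomial p q _

theorem divX_X_mul (j : σ) (p : MvPolynomial σ k) : divX j (X j * p) = p :=
  X_mul_divMonomial j p

theorem divX_X_mul_of_ne {i j : σ} (h : i ≠ j) (p : MvPolynomial σ k) :
    divX j (X i * p) = X i * divX j p := by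
  classical
  ext m
  change coeff m ((X i * p).divMonomial _) = coeff m (X i * p.divMonomial _)
  have hi : i ∈ (Finsupp.single j 1 + m).support ↔ i ∈ m.support := by simp [h.symm]
  rw [coeff_divMonomial, coeff_X_mul', coeff_X_mul', coeff_divMonomial]
  simp only [hi]
  split_ifs with him
  · rw [add_tsub_assoc_of_le]
    exact Finsupp.single_le_iff.2 (Nat.one_le_iff_ne_zero.2 (Finsupp.mem_support_iff.1 him))
  · rfl

theorem divX_mem_intGrading (e : σ → ℕ) (j : σ) (n : ℤ) (p : MvPolynomial σ k)
    (hp : p ∈ intGrading (weightedHomogeneousSubmodule k e) n) :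
    divX j p ∈ intGrading (weightedHomogeneousSubmodule k e) (n - e j) := by
  match n with
  | .negSucc n =>
    rw [AddSubgroup.mem_bot.1 hp, map_zero]
    exact zero_mem _
  | .ofNat n =>
    have hw : ∀ m, coeff m (divX j p) ≠ 0 → e j + Finsupp.weight e m = n := by
      intro m hm
      have := hp (show coeff (Finsupp.single j 1 + m) p ≠ 0 by rwa [← coeff_divMonomial])
      simpa [map_add, Finsupp.weight_single] using this
    rcases eq_or_ne (divX j p) 0 with h0 | h0
    · rw [h0]
      exact zero_mem _
    · obtain ⟨m, hm⟩ := ne_zero_iff.1 h0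
      have hn : Int.ofNat n - e j = ((n - e j : ℕ) : ℤ) := by
        have := hw m hm
        lia
      rw [hn, mem_intGrading_natCast, mem_weightedHomogeneousSubmodule]
      intro m' hm'
      have := hw m' hm'
      lia

theorem mem_iSup_X_smul {e : σ → ℕ} {l : List σ} (hl : ∀ j, j ∈ l) {d : ℕ} (hd : 0 < d)
    {p : MvPolynomial σ k} (hp : p.IsWeightedHomogeneous e d) :
    p ∈ ⨆ i ∈ l, (X i : MvPolynomial σ k) •
      intGrading (weightedHomogeneousSubmodule k e) ((d : ℤ) - e i) := by
  rw [p.as_sum]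
  refine sum_mem fun m hm => ?_
  have hmd := hp (mem_support_iff.1 hm)
  have hm0 : m ≠ 0 := by
    rintro rfl
    rw [map_zero] at hmd
    exact hd.ne hmd
  obtain ⟨j, hj⟩ := Finsupp.ne_iff.1 hm0
  have hdiv : (monomial m (coeff m p) : MvPolynomial σ k) =
      X j * monomial (m - Finsupp.single j 1) (coeff m p) := by
    rw [X, monomial_mul, one_mul,
      add_tsub_cancel_of_le (Finsupp.single_le_iff.2 (Nat.one_le_iff_ne_zero.2 hj))]
  have hmem := divX_mem_intGrading e j d _
    (mem_intGrading_natCast.2 (isWeightedHomogeneous_monomial e m (coeff m p) hmd))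
  rw [hdiv, divX_X_mul] at hmem
  rw [hdiv]
  exact AddSubgroup.mem_iSup_of_mem j (AddSubgroup.mem_iSup_of_mem (hl j)
    (AddSubgroup.smul_mem_pointwise_smul _ _ _ hmem))

theorem X_mem_intGrading (e : σ → ℕ) (j : σ) :
    (X j : MvPolynomial σ k) ∈ intGrading (weightedHomogeneousSubmodule k e) (e j) :=
  mem_intGrading_natCast.2 (isWeightedHomogeneous_X k e j)

theorem isKoszulResolution_X {e : σ → ℕ} (he : ∀ j, 0 < e j) {l : List σ} (hl : ∀ j, j ∈ l)
    (hl' : l.Nodup) :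
    IsKoszulResolution (intGrading (weightedHomogeneousSubmodule k e)) (fun j => (e j : ℤ))
      (X : σ → MvPolynomial σ k) l where
  eq_bot := intGrading_eq_bot
  mem := X_mem_intGrading e
  pos j := Nat.cast_pos.2 (he j)
  acyclic p d h := by
    have := WeightedHomogeneousSubmodule.gradedMonoid (R := k) (w := e)
    rcases lt_trichotomy p 0 with hp | rfl | hp
    · exact acyclic_of_neg hp
    · rw [acyclic_zero_iff]
      have hd : 0 < d := h.resolve_left (lt_irrefl 0)
      obtain ⟨d, rfl⟩ := Int.eq_ofNat_of_zero_le hd.le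
      exact fun p hp => mem_iSup_X_smul hl (Nat.cast_pos.1 hd) hp
    · exact acyclic_of_leftInverse (X_mem_intGrading e) divX_X_mul (fun _ _ => divX_X_mul_of_ne)
        (divX_mem_intGrading e) hl' hp d

end Polynomial

/-! ### Tor and Koszul homology -/

section PositiveIdeal

open Pointwise Koszul

variable {σ : Type*} {k : Type*} [Field k] {A : Type u} [CommRing A] [Algebra k A]
  {𝒜 : ℕ → Submodule k A} {e : σ → ℤ} {x : σ → A} {l : List σ}

theorem Koszul.IsKoszulResolution.mem_positiveIdeal
    (hx : IsKoszulResolution (intGrading 𝒜) e x l) (i : σ) : x i ∈ positiveIdeal 𝒜 := by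
  obtain ⟨n, hn⟩ := Int.eq_ofNat_of_zero_le (hx.pos i).le
  have hi := hx.pos i
  have hm := hx.mem i
  rw [hn] at hi hm
  exact Ideal.subset_span ⟨n, Nat.cast_pos.1 hi, mem_intGrading_natCast.1 hm⟩

theorem Koszul.IsKoszulResolution.positiveIdeal_le
    (hx : IsKoszulResolution (intGrading 𝒜) e x l) :
    positiveIdeal 𝒜 ≤ Ideal.span (x '' {i | i ∈ l}) := by
  refine Ideal.span_le.2 ?_
  rintro a ⟨n, hn, ha⟩
  have h := acyclic_zero_iff.1 (hx.acyclic 0 n (Or.inr (Nat.cast_pos.2 hn)))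
    (mem_intGrading_natCast.2 ha)
  refine (iSup₂_le fun i hi => ?_ : _ ≤ (Ideal.span (x '' {i | i ∈ l})).toAddSubgroup) h
  rintro _ ⟨y, -, rfl⟩
  exact Ideal.mul_mem_right _ _ (Ideal.subset_span ⟨i, hi, rfl⟩)

variable {N : Type*} [AddCommGroup N] [Module A N] {P : ℤ → AddSubgroup N}

theorem Koszul.IsKoszulResolution.iSup_smul_le (hx : IsKoszulResolution (intGrading 𝒜) e x l)
    (d : ℤ) : ⨆ i ∈ l, x i • P (d - e i) ≤
      (positiveIdeal 𝒜 • (⊤ : Submodule A N)).toAddSubgroup := by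
  refine iSup₂_le fun i _ => ?_
  rintro _ ⟨y, -, rfl⟩
  exact Submodule.smul_mem_smul (hx.mem_positiveIdeal i) trivial

theorem Koszul.IsKoszulResolution.mem_iSup_smul [SetLike.GradedSMul (intGrading 𝒜) P]
    (hx : IsKoszulResolution (intGrading 𝒜) e x l) (hP : iSupIndep P) (hP' : ⨆ n, P n = ⊤)
    {d : ℤ} {y : N} (hy : y ∈ P d) (hyI : y ∈ positiveIdeal 𝒜 • (⊤ : Submodule A N)) :
    y ∈ ⨆ i ∈ l, x i • P (d - e i) := by
  set Q : ℤ → AddSubgroup N := fun d => ⨆ i ∈ l, x i • P (d - e i)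
  have hQP : Q ≤ P := by
    refine fun d => iSup₂_le fun i _ => ?_
    rintro _ ⟨y, hy, rfl⟩
    have : x i • y ∈ P (e i + (d - e i)) := SetLike.GradedSMul.smul_mem (hx.mem i) hy
    rwa [add_sub_cancel] at this
  refine inf_iSup_le_of_iSupIndep hP hQP d ⟨hy, ?_⟩
  have hsmul : ∀ i ∈ l, ∀ y : N, x i • y ∈ ⨆ d, Q d := by
    intro i hi y
    suffices h : ⨆ n, P n ≤ (⨆ d, Q d).comap (DistribSMul.toAddMonoidHom N (x i)) from
      h (hP' ▸ AddSubgroup.mem_top y)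
    refine iSup_le fun n y hy => AddSubgroup.mem_iSup_of_mem (n + e i)
      (AddSubgroup.mem_iSup_of_mem i (AddSubgroup.mem_iSup_of_mem hi
        (AddSubgroup.smul_mem_pointwise_smul _ _ _ ?_)))
    rwa [add_sub_cancel_right]
  refine Submodule.smul_induction_on hyI (fun a ha y _ => ?_) fun _ _ => add_mem
  replace ha := hx.positiveIdeal_le ha
  induction ha using Submodule.span_induction generalizing y with
  | mem a ha =>
    obtain ⟨i, hi, rfl⟩ := ha
    exact hsmul i hi y
  | zero =>
    rw [zero_smul]
    exact zero_mem _
  | add a b _ _ ha hb =>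
    rw [add_smul]
    exact add_mem (ha y trivial) (hb y trivial)
  | smul c a _ ha =>
    rw [smul_eq_mul, mul_comm, mul_smul]
    exact ha _ trivial

end PositiveIdeal

namespace GradedFreeResolution

open Koszul Pointwise

section Syzygies

variable {k : Type*} [Field k] {A : Type u} [CommRing A] [Algebra k A] {M : Type v}
  [AddCommGroup M] [Module k M] [Module A M] {𝒜 : ℕ → Submodule k A} {ℳ : ℕ → Submodule k M}
  (F : GradedFreeResolution 𝒜 ℳ)

/-- The grading of the terms of the resolution, indexed by the integers. -/
abbrev grading (i : ℕ) : ℤ → AddSubgroup (F.J i →₀ A) :=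
  freeGrading (intGrading 𝒜) fun j => (F.deg i j : ℤ)

theorem grading_eq_bot (i : ℕ) : ∀ n < 0, F.grading i n = ⊥ := fun _ hn =>
  freeGrading_eq_bot intGrading_eq_bot (fun _ => Int.natCast_nonneg _) hn

theorem d_mem_grading (i : ℕ) (n : ℤ) : ∀ g ∈ F.grading (i + 1) n, F.d i g ∈ F.grading i n :=
  forall_mem_of_natCast (φ := (F.d i).toAddMonoidHom) (F.grading_eq_bot _)
    (fun n g hg => mem_freePiece_iff.1 (F.d_graded i n g (mem_freePiece_iff.2 hg))) n

theorem ε_mem_intGrading (n : ℤ) : ∀ g ∈ F.grading 0 n, F.ε g ∈ intGrading ℳ n :=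
  forall_mem_of_natCast (φ := F.ε.toAddMonoidHom) (F.grading_eq_bot _)
    (fun n g hg => mem_intGrading_natCast.2 (F.ε_graded n g (mem_freePiece_iff.2 hg))) n

theorem map_ε_eq (h𝒜 : DirectSum.IsInternal 𝒜) (hℳ : iSupIndep (intGrading ℳ)) (n : ℤ) :
    (F.grading 0 n).map F.ε.toAddMonoidHom = intGrading ℳ n := by
  refine le_antisymm (AddSubgroup.map_le_iff_le_comap.2 (F.ε_mem_intGrading n)) fun y hy => ?_
  obtain ⟨g, rfl⟩ := F.ε_surjective y
  exact exists_mem_map_eq (φ := F.ε.toAddMonoidHom)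
    (iSup_freeGrading (iSup_intGrading h𝒜.submodule_iSup_eq_top)) hℳ F.ε_mem_intGrading hy

/-- The grading of the first syzygy module. -/
def syzygyPiece (n : ℕ) : Submodule k (LinearMap.ker F.ε) where
  carrier := {y | (y : F.J 0 →₀ A) ∈ freePiece 𝒜 (F.deg 0) n}
  zero_mem' := fun _ => zero_mem _
  add_mem' := fun hy hz j => add_mem (hy j) (hz j)
  smul_mem' := fun c _ hy j => Submodule.smul_mem _ c (hy j)

theorem intGrading_syzygyPiece :
    intGrading F.syzygyPiece = subGrading (F.grading 0) (LinearMap.ker F.ε) := by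
  funext n
  match n with
  | .ofNat n => exact AddSubgroup.ext fun _ => mem_freePiece_iff
  | .negSucc n => exact (subGrading_eq_bot (F.grading_eq_bot 0 _ (Int.negSucc_lt_zero n))).symm

/-- The first differential, as a map onto the first syzygy module. -/
def toSyzygy : (F.J 1 →₀ A) →ₗ[A] LinearMap.ker F.ε :=
  (F.d 0).codRestrict _ fun g => F.exact_zero.apply_apply_eq_zero g

theorem toSyzygy_eq_zero_iff {g : F.J 1 →₀ A} : F.toSyzygy g = 0 ↔ F.d 0 g = 0 :=
  Subtype.ext_iff

/-- The resolution of the first syzygy module. -/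
def tail : GradedFreeResolution (M := LinearMap.ker F.ε) 𝒜 F.syzygyPiece where
  J i := F.J (i + 1)
  deg i := F.deg (i + 1)
  d i := F.d (i + 1)
  ε := F.toSyzygy
  d_graded i := F.d_graded (i + 1)
  ε_graded := F.d_graded 0
  ε_surjective y := by
    obtain ⟨g, hg⟩ := (F.exact_zero y).1 y.2
    exact ⟨g, Subtype.ext hg⟩
  exact_zero g := F.toSyzygy_eq_zero_iff.trans (F.exact_succ 0 g)
  exact_succ i := F.exact_succ (i + 1)

end Syzygies

section Tor

variable {σ : Type*} {k : Type*} [Field k] {A : Type u} [CommRing A] [Algebra k A]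
  {𝒜 : ℕ → Submodule k A} {e : σ → ℤ} {x : σ → A} {l : List σ} {d : ℕ}

section

variable {M : Type v} [AddCommGroup M] [Module k M] [Module A M] {ℳ : ℕ → Submodule k M}
  (F : GradedFreeResolution 𝒜 ℳ)

theorem exists_mem_positiveIdeal_smul (hx : IsKoszulResolution (intGrading 𝒜) e x l)
    {P : ℤ → AddSubgroup M} {c : ℤ} {y : M} (hy : y ∈ ⨆ i ∈ l, x i • P (c - e i)) :
    ∃ g ∈ positiveIdeal 𝒜 • (⊤ : Submodule A (F.J 0 →₀ A)), F.ε g = y := by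
  have h := hx.iSup_smul_le c hy
  rwa [← LinearMap.range_eq_top.2 F.ε_surjective, LinearMap.range_eq_map,
    ← Submodule.map_smul''] at h

theorem mem_boundaries_zero (hx : IsKoszulResolution (intGrading 𝒜) e x l)
    (h : Acyclic e (intGrading ℳ) x l 0 d) {z : F.J 0 →₀ A} (hz : z ∈ freePiece 𝒜 (F.deg 0) d) :
    z ∈ F.boundaries 0 := by
  obtain ⟨g, hg, hgz⟩ := F.exists_mem_positiveIdeal_smul hx
    (acyclic_zero_iff.1 h (F.ε_mem_intGrading d z (mem_freePiece_iff.1 hz)))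
  have hker : F.ε (z - g) = 0 := by rw [map_sub, hgz, sub_self]
  rw [← add_sub_cancel g z]
  exact Submodule.add_mem_sup hg ((F.exact_zero _).1 hker)

theorem mem_boundaries_one_of_toSyzygy (hx : IsKoszulResolution (intGrading 𝒜) e x l)
    {P : ℤ → AddSubgroup (LinearMap.ker F.ε)} {c : ℤ} {z : F.J 1 →₀ A}
    (hz : F.toSyzygy z ∈ ⨆ i ∈ l, x i • P (c - e i)) : z ∈ F.boundaries 1 := by
  obtain ⟨(g : F.J 1 →₀ A), hg, hgz⟩ := F.tail.exists_mem_positiveIdeal_smul hx hz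
  have hker : F.d 0 (z - g) = 0 := by
    rw [← toSyzygy_eq_zero_iff, map_sub, sub_eq_zero]
    exact hgz.symm
  rw [← add_sub_cancel g z]
  exact Submodule.add_mem_sup hg ((F.exact_succ 0 _).1 hker)

theorem toSyzygy_mem_of_mem_boundaries {z : F.J 1 →₀ A} (hz : z ∈ F.boundaries 1) :
    F.toSyzygy z ∈ positiveIdeal 𝒜 • (⊤ : Submodule A (LinearMap.ker F.ε)) := by
  obtain ⟨g, hg, _, ⟨h, rfl⟩, rfl⟩ := Submodule.mem_sup.1 hz
  have hdd : F.toSyzygy (F.d 1 h) = 0 :=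
    F.toSyzygy_eq_zero_iff.2 ((F.exact_succ 0).apply_apply_eq_zero h)
  rw [map_add, hdd, add_zero]
  have hmap := Submodule.mem_map_of_mem (f := F.toSyzygy) hg
  rw [Submodule.map_smul''] at hmap
  exact Submodule.smul_mono le_rfl le_top hmap

variable [SetLike.GradedMonoid 𝒜]

theorem mem_iSup_smul_of_mem_cycles (hx : IsKoszulResolution (intGrading 𝒜) e x l)
    (h𝒜 : DirectSum.IsInternal 𝒜) {y : F.J 0 →₀ A} (hy : y ∈ F.grading 0 d)
    (hyI : y ∈ positiveIdeal 𝒜 • (⊤ : Submodule A (F.J 0 →₀ A))) :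
    y ∈ ⨆ i ∈ l, x i • F.grading 0 (d - e i) :=
  hx.mem_iSup_smul (iSupIndep_freeGrading (iSupIndep_intGrading h𝒜))
    (iSup_freeGrading (iSup_intGrading h𝒜.submodule_iSup_eq_top)) hy hyI

theorem mem_boundaries_one (hx : IsKoszulResolution (intGrading 𝒜) e x l)
    (h𝒜 : DirectSum.IsInternal 𝒜) (hℳ : iSupIndep (intGrading ℳ))
    (h : Acyclic e (intGrading ℳ) x l 1 d) {z : F.J 1 →₀ A}
    (hz : z ∈ freePiece 𝒜 (F.deg 1) d) (hzc : z ∈ F.cycles 1) : z ∈ F.boundaries 1 := by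
  have hdz : F.d 0 z ∈ F.grading 0 d := F.d_mem_grading 0 d z (mem_freePiece_iff.1 hz)
  obtain ⟨w, hw, hwz⟩ := exists_bd_eq_incl_iff.2 (F.mem_iSup_smul_of_mem_cycles hx h𝒜 hdz hzc)
  obtain ⟨v, hv, hvz⟩ := kerInjective_of_acyclic_codomain (p := 0) hx.mem (F.map_ε_eq h𝒜 hℳ)
    (by rwa [zero_add]) (incl l (F.toSyzygy z)) (mem_piece_zero.2 ⟨_, hdz, rfl⟩) w
    (by rwa [zero_add]) (by rw [hwz, map_incl]; rfl)
  rw [zero_add] at hv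
  exact F.mem_boundaries_one_of_toSyzygy hx (exists_bd_eq_incl_iff.1 ⟨v, hv, hvz⟩)

theorem acyclic_one (hx : IsKoszulResolution (intGrading 𝒜) e x l)
    (h𝒜 : DirectSum.IsInternal 𝒜) (hℳ : iSupIndep (intGrading ℳ))
    (h : ∀ z ∈ F.cycles 1, z ∈ freePiece 𝒜 (F.deg 1) d → z ∈ F.boundaries 1) :
    Acyclic e (intGrading ℳ) x l 1 d := by
  refine KerInjective.acyclic_codomain hx.mem (F.map_ε_eq h𝒜 hℳ) ?_
    (acyclic_free fun j => hx.acyclic 1 _ (Or.inl one_pos))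
  rw [sub_self]
  intro u hu w hw hwu
  obtain ⟨y, hy, rfl⟩ := mem_piece_zero.1 hu
  have hyI : (y : F.J 0 →₀ A) ∈ positiveIdeal 𝒜 • (⊤ : Submodule A (F.J 0 →₀ A)) :=
    hx.iSup_smul_le d (exists_bd_eq_incl_iff.1 ⟨w, hw, hwu.trans (map_incl _ l y)⟩)
  have hsyz : iSupIndep (subGrading (F.grading 0) (LinearMap.ker F.ε)) :=
    iSupIndep_subGrading (iSupIndep_freeGrading (iSupIndep_intGrading h𝒜))
  obtain ⟨g, hg, rfl⟩ : y ∈ (F.grading 1 d).map F.toSyzygy.toAddMonoidHom := by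
    rw [← F.intGrading_syzygyPiece] at hy hsyz
    exact (F.tail.map_ε_eq h𝒜 hsyz d).ge hy
  exact exists_bd_eq_incl_iff.2 (hx.mem_iSup_smul hsyz
    (iSup_subGrading_ker (iSup_freeGrading (iSup_intGrading h𝒜.submodule_iSup_eq_top)) hℳ
      F.ε_mem_intGrading) hy (F.toSyzygy_mem_of_mem_boundaries (h g hyI (mem_freePiece_iff.2 hg))))

end

theorem mem_boundaries_succ [SetLike.GradedMonoid 𝒜]
    (hx : IsKoszulResolution (intGrading 𝒜) e x l) (h𝒜 : DirectSum.IsInternal 𝒜) (i : ℕ)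
    {M : Type u} [AddCommGroup M] [Module k M] [Module A M] {ℳ : ℕ → Submodule k M}
    (F : GradedFreeResolution 𝒜 ℳ) (hℳ : iSupIndep (intGrading ℳ))
    (h : Acyclic e (intGrading ℳ) x l (i + 1 : ℕ) d) {z : F.J (i + 1) →₀ A}
    (hz : z ∈ freePiece 𝒜 (F.deg (i + 1)) d) (hzc : z ∈ F.cycles (i + 1)) :
    z ∈ F.boundaries (i + 1) := by
  induction i generalizing M with
  | zero => exact F.mem_boundaries_one hx h𝒜 hℳ (by simpa using h) hz hzc
  | succ i ih =>
    have hdeg : iSupIndep (F.grading 0) := iSupIndep_freeGrading (iSupIndep_intGrading h𝒜)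
    refine ih F.tail ?_ ?_ hz hzc
    · rw [intGrading_syzygyPiece]
      exact iSupIndep_subGrading hdeg
    · rw [intGrading_syzygyPiece]
      exact Koszul.acyclic_ker (acyclic_free fun j => hx.acyclic _ _ (Or.inl (by positivity)))
        (kerInjective_of_acyclic_codomain hx.mem (F.map_ε_eq h𝒜 hℳ) (by exact_mod_cast h))

end Tor

end GradedFreeResolution

section Existence

variable {k : Type*} [Field k] {A : Type u} [CommRing A] [Algebra k A] {N : Type u}
  [AddCommGroup N] [Module A N]

/-- A homogeneous element of `K` with its degree. All of them together are used as a set of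
homogeneous generators of `K`. -/
def HomogeneousElement (P : ℤ → AddSubgroup N) (K : Submodule A N) : Type u :=
  {y : ℕ × N // y.2 ∈ P y.1 ∧ y.2 ∈ K}

/-- The map onto `K` from the free module on the homogeneous elements of `K`. -/
def cover (P : ℤ → AddSubgroup N) (K : Submodule A N) : (HomogeneousElement P K →₀ A) →ₗ[A] N :=
  Finsupp.linearCombination A fun y => y.1.2

variable {𝒜 : ℤ → AddSubgroup A} {P : ℤ → AddSubgroup N} {K : Submodule A N}

theorem range_cover (hP : ∀ n < 0, P n = ⊥) (hK : ⨆ n, subGrading P K n = ⊤) :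
    LinearMap.range (cover P K) = K := by
  rw [cover, Finsupp.range_linearCombination]
  refine le_antisymm (Submodule.span_le.2 ?_) fun y hy => ?_
  · rintro _ ⟨y, rfl⟩
    exact y.2.2
  · set S := Submodule.span A (Set.range fun y : HomogeneousElement P K => y.1.2)
    suffices h : ⨆ n, subGrading P K n ≤ (S.comap K.subtype).toAddSubgroup from
      h (hK ▸ AddSubgroup.mem_top (⟨y, hy⟩ : K))
    exact iSup_le fun n => forall_mem_of_natCast (φ := AddMonoidHom.id K)
      (P' := fun _ => (S.comap K.subtype).toAddSubgroup) (fun n hn => subGrading_eq_bot (hP n hn))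
      (fun n y hy => Submodule.subset_span ⟨⟨(n, y), hy, y.2⟩, rfl⟩) n

theorem cover_mem [SetLike.GradedSMul 𝒜 P] (n : ℤ) :
    ∀ g ∈ freeGrading 𝒜 (fun y : HomogeneousElement P K => (y.1.1 : ℤ)) n, cover P K g ∈ P n :=
  fun _ => linearCombination_mem fun y => y.2.1

/-- A submodule of a free module whose basis elements have degrees. -/
structure FreeSubmodule (A : Type u) [CommRing A] where
  J : Type u
  deg : J → ℕ
  submodule : Submodule A (J →₀ A)

/-- The grading of the free module that contains `K`, when `A` is graded by `𝒜`. -/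
abbrev FreeSubmodule.grading (𝒜 : ℤ → AddSubgroup A) (K : FreeSubmodule A) :
    ℤ → AddSubgroup (K.J →₀ A) :=
  freeGrading 𝒜 fun j => (K.deg j : ℤ)

/-- The relations between the homogeneous elements of `K`. -/
def relations (P : ℤ → AddSubgroup N) (K : Submodule A N) : FreeSubmodule A where
  J := HomogeneousElement P K
  deg y := y.1.1
  submodule := LinearMap.ker (cover P K)

theorem iSup_subGrading_relations [SetLike.GradedSMul 𝒜 P] (h𝒜 : ⨆ n, 𝒜 n = ⊤)
    (hP : iSupIndep P) :
    ⨆ n, subGrading ((relations P K).grading 𝒜) (relations P K).submodule n = ⊤ :=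
  iSup_subGrading_ker (iSup_freeGrading h𝒜) hP cover_mem

/-- The iterated syzygies of the graded module `P`. -/
def syzygies (𝒜 : ℤ → AddSubgroup A) (P : ℤ → AddSubgroup N) : ℕ → FreeSubmodule A
  | 0 => relations P ⊤
  | i + 1 => relations ((syzygies 𝒜 P i).grading 𝒜) (syzygies 𝒜 P i).submodule

theorem iSup_subGrading_syzygies [SetLike.GradedMonoid 𝒜] [SetLike.GradedSMul 𝒜 P]
    (h𝒜 : ⨆ n, 𝒜 n = ⊤) (h𝒜' : iSupIndep 𝒜) (hP : iSupIndep P) : ∀ i,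
    ⨆ n, subGrading ((syzygies 𝒜 P i).grading 𝒜) (syzygies 𝒜 P i).submodule n = ⊤
  | 0 => iSup_subGrading_relations h𝒜 hP
  | _ + 1 => iSup_subGrading_relations h𝒜 (iSupIndep_freeGrading h𝒜')

theorem nonempty_gradedFreeResolution [Module k N] {𝒜 : ℕ → Submodule k A}
    {ℳ : ℕ → Submodule k N} [SetLike.GradedMonoid 𝒜] [SetLike.GradedSMul 𝒜 ℳ]
    (h𝒜 : DirectSum.IsInternal 𝒜) (hℳ : iSupIndep (intGrading ℳ)) (hℳ' : ⨆ n, ℳ n = ⊤) :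
    Nonempty (GradedFreeResolution 𝒜 ℳ) := by
  have hi (i : ℕ) := range_cover
    (fun n hn => freeGrading_eq_bot intGrading_eq_bot (fun _ => Int.natCast_nonneg _) hn)
    (iSup_subGrading_syzygies (iSup_intGrading h𝒜.submodule_iSup_eq_top)
      (iSupIndep_intGrading h𝒜) hℳ i)
  have hε : Function.Surjective (cover (intGrading ℳ) (⊤ : Submodule A N)) := by
    have hker := iSup_subGrading_ker (φ := (0 : N →ₗ[A] N)) (iSup_intGrading hℳ') hℳ
      fun _ _ _ => zero_mem _
    rw [LinearMap.ker_zero] at hker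
    exact LinearMap.range_eq_top.1 (range_cover intGrading_eq_bot hker)
  exact ⟨{
    J i := (syzygies (intGrading 𝒜) (intGrading ℳ) i).J
    deg i := (syzygies (intGrading 𝒜) (intGrading ℳ) i).deg
    d i := cover _ (syzygies (intGrading 𝒜) (intGrading ℳ) i).submodule
    ε := cover (intGrading ℳ) ⊤
    d_graded i n g hg := mem_freePiece_iff.2 (cover_mem n g (mem_freePiece_iff.1 hg))
    ε_graded n g hg := cover_mem (K := ⊤) n g (mem_freePiece_iff.1 hg)
    ε_surjective := hε
    exact_zero g := (SetLike.ext_iff.1 (hi 0) g).symm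
    exact_succ i g := (SetLike.ext_iff.1 (hi (i + 1)) g).symm }⟩

end Existence

section TorEnd

theorem torEnd_le {k : Type u} {A : Type v} {M : Type w} [Field k] [CommRing A] [Algebra k A]
    [AddCommGroup M] [Module k M] [Module A M] {𝒜 : ℕ → Submodule k A} {ℳ : ℕ → Submodule k M}
    {i : ℕ} {c : ℝ} (h : ∀ (F : GradedFreeResolution 𝒜 ℳ) (d : ℕ), c < d → ∀ z ∈ F.cycles i,
      z ∈ freePiece 𝒜 (F.deg i) d → z ∈ F.boundaries i) : torEnd 𝒜 ℳ i ≤ c := by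
  refine iSup_le fun F => iSup₂_le fun d ⟨t, ⟨z, hz, hzd, hzt⟩, ht⟩ => ?_
  by_contra! hlt
  refine ht (Subtype.ext ?_)
  rw [← hzt]
  exact (Submodule.Quotient.mk_eq_zero _).2 (h F d (by exact_mod_cast hlt) z hz hzd)

theorem GradedFreeResolution.mem_boundaries_of_torEnd_lt {k : Type u} {A : Type v} {M : Type w}
    [Field k] [CommRing A] [Algebra k A] [AddCommGroup M] [Module k M] [Module A M]
    {𝒜 : ℕ → Submodule k A} {ℳ : ℕ → Submodule k M} {i d : ℕ} (h : torEnd 𝒜 ℳ i < d)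
    (F : GradedFreeResolution 𝒜 ℳ) {z : F.J i →₀ A} (hz : z ∈ F.cycles i)
    (hzd : z ∈ freePiece 𝒜 (F.deg i) d) : z ∈ F.boundaries i := by
  by_contra hzb
  have hle : (d : EReal) ≤ gradedEnd (F.torPiece i) :=
    le_iSup₂_of_le d ⟨⟨_, Submodule.mem_map_of_mem hz⟩, ⟨z, hz, hzd, rfl⟩, fun h0 =>
      hzb ((Submodule.Quotient.mk_eq_zero _).1 (congrArg Subtype.val h0))⟩ le_rfl
  exact h.not_ge (hle.trans (le_iSup (fun F : GradedFreeResolution 𝒜 ℳ =>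
    gradedEnd (F.torPiece i)) F))

open Koszul

variable {σ : Type*} {k : Type u} [Field k] {A : Type u} [CommRing A] [Algebra k A]
  {𝒜 : ℕ → Submodule k A} [SetLike.GradedMonoid 𝒜] {e : σ → ℤ} {x : σ → A} {l : List σ}
  {M : Type u} [AddCommGroup M] [Module k M] [Module A M] {ℳ : ℕ → Submodule k M}

theorem torEnd_le_of_acyclic (hx : IsKoszulResolution (intGrading 𝒜) e x l)
    (h𝒜 : DirectSum.IsInternal 𝒜) (hℳ : iSupIndep (intGrading ℳ)) {i : ℕ} {c : ℝ}
    (h : ∀ d : ℕ, c < d → Acyclic e (intGrading ℳ) x l i d) : torEnd 𝒜 ℳ i ≤ c := by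
  refine torEnd_le fun F d hd z hzc hz => ?_
  cases i with
  | zero => exact F.mem_boundaries_zero hx (h d hd) hz
  | succ i => exact F.mem_boundaries_succ hx h𝒜 i hℳ (h d hd) hz hzc

theorem acyclic_one_of_torEnd_lt [SetLike.GradedSMul 𝒜 ℳ]
    (hx : IsKoszulResolution (intGrading 𝒜) e x l) (h𝒜 : DirectSum.IsInternal 𝒜)
    (hℳ : iSupIndep (intGrading ℳ)) (hℳ' : ⨆ n, ℳ n = ⊤) {d : ℕ} (h : torEnd 𝒜 ℳ 1 < d) :
    Acyclic e (intGrading ℳ) x l 1 d := by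
  obtain ⟨F⟩ := nonempty_gradedFreeResolution h𝒜 hℳ hℳ'
  exact F.acyclic_one hx h𝒜 hℳ fun z hz hzd => F.mem_boundaries_of_torEnd_lt h hz hzd

end TorEnd

/-! ### The Noether bound -/

section Noether

variable {R B H : Type*} [CommRing R] [CommRing B] [Algebra R B] [Group H]
  [MulSemiringAction H B]

variable [Algebra.IsInvariant R B H] (π : B →ₗ[R] R)

theorem sum_smul_mul_algebraMap [Fintype H] (x y : B) :
    (∑ h : H, h • x) * algebraMap R B (π y) = algebraMap R B (π ((∑ h : H, h • x) * y)) := by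
  obtain ⟨r, hr⟩ := Algebra.IsInvariant.isInvariant (A := R) (G := H) (∑ h : H, h • x) fun g => by
    rw [Finset.smul_sum]
    simp only [smul_smul]
    exact Fintype.sum_equiv (Equiv.mulLeft g) _ _ fun _ => rfl
  rw [← hr, ← Algebra.smul_def r y, map_smul, smul_eq_mul, map_mul]

variable [SMulCommClass H R B] {ι : Type*} {s : Finset ι} {a c : ι → B}

/-- Writing the sum over `H` of `h • (x * a i)` as an invariant, it can be moved inside `π`, where
it meets the hypothesis translated by `h`. -/
theorem sum_smul_mul_smul_eq_zero [Fintype H]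
    (hac : ∀ g : H, ∑ i ∈ s, a i * g • c i = 0) (x : B) :
    ∑ h : H, h • (∑ i ∈ s, a i * algebraMap R B (π (c i))) * h • x = 0 :=
  calc ∑ h : H, h • (∑ i ∈ s, a i * algebraMap R B (π (c i))) * h • x
      = ∑ i ∈ s, (∑ h : H, h • (x * a i)) * algebraMap R B (π (c i)) := by
        simp only [Finset.smul_sum, Finset.sum_mul, smul_mul', smul_algebraMap]
        rw [Finset.sum_comm]
        exact Finset.sum_congr rfl fun i _ => Finset.sum_congr rfl fun h _ => by ring
    _ = algebraMap R B (π (∑ i ∈ s, (∑ h : H, h • (x * a i)) * c i)) := by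
        simp only [sum_smul_mul_algebraMap, map_sum]
    _ = algebraMap R B (π (∑ h : H, h • (x * ∑ i ∈ s, a i * h⁻¹ • c i))) := by
        simp only [Finset.sum_mul, Finset.smul_sum, Finset.mul_sum, smul_mul', smul_inv_smul]
        rw [Finset.sum_comm]
        simp only [mul_assoc]
    _ = 0 := by simp only [hac, mul_zero, smul_zero, Finset.sum_const_zero, map_zero]

variable [IsDomain B] [FaithfulSMul H B]

theorem eq_zero_of_forall_sum_mul_smul_eq_zero [Fintype H] {c : H → B}
    (hc : ∀ x, ∑ h, c h * h • x = 0) (h : H) : c h = 0 := by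
  have hinj : Function.Injective fun h : H => (MulSemiringAction.toRingHom H B h : B →* B) :=
    fun g h hgh => FaithfulSMul.eq_of_smul_eq_smul fun x : B => DFunLike.congr_fun hgh x
  refine Fintype.linearIndependent_iff.1 ((linearIndependent_monoidHom B B).comp _ hinj) c ?_ h
  funext x
  exact (Finset.sum_apply x _ _).trans (hc x)

theorem sum_mul_algebraMap_eq_zero [Finite H]
    (hac : ∀ g : H, ∑ i ∈ s, a i * g • c i = 0) :
    ∑ i ∈ s, a i * algebraMap R B (π (c i)) = 0 := by
  have := Fintype.ofFinite H
  rw [← one_smul H (∑ i ∈ s, _)]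
  exact eq_zero_of_forall_sum_mul_smul_eq_zero (sum_smul_mul_smul_eq_zero π hac) 1

/-- Benson's proof of the Noether bound: every `g` kills the product over `h` of
`f h - g • h • f h`; in its expansion, `g` can be replaced by `π`. -/
theorem prod_mem_of_forall_algebraMap_mem [Fintype H] (hπ : π 1 = 1) {I : Ideal B}
    {f : H → B} (hf : ∀ t : Finset H, t.Nonempty → algebraMap R B (π (∏ h ∈ t, h • f h)) ∈ I) :
    ∏ h, f h ∈ I := by
  classical
  have hexpand : ∀ g : H, ∑ t ∈ Finset.univ.powerset,
      ((-1) ^ t.card * ∏ h ∈ Finset.univ \ t, f h) * g • ∏ h ∈ t, h • f h = 0 := by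
    intro g
    have hprod : ∏ h : H, (-(g • h • f h) + f h) = 0 :=
      Finset.prod_eq_zero (Finset.mem_univ g⁻¹) (by rw [smul_inv_smul, neg_add_cancel])
    rw [← hprod, Finset.prod_add]
    refine Finset.sum_congr rfl fun t _ => ?_
    rw [Finset.smul_prod', Finset.prod_neg]
    ring
  have hsum := sum_mul_algebraMap_eq_zero π hexpand
  rw [← Finset.add_sum_erase _ _ (Finset.empty_mem_powerset _)] at hsum
  simp only [Finset.card_empty, pow_zero, Finset.sdiff_empty, one_mul, Finset.prod_empty, hπ,
    map_one, mul_one] at hsum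
  rw [eq_neg_of_add_eq_zero_left hsum]
  refine neg_mem (sum_mem fun t ht => Ideal.mul_mem_left _ _ (hf t ?_))
  exact Finset.nonempty_iff_ne_empty.2 (Finset.ne_of_mem_erase ht)

end Noether

/-! ### Invariants of polynomial rings -/

section Invariants

open MvPolynomial

variable {k : Type u} [Field k]

theorem homogeneousComponent_map_of_isHomogeneous {σ τ : Type*}
    {φ : MvPolynomial σ k →+ MvPolynomial τ k} {c : ℕ}
    (hφ : ∀ m p, p.IsHomogeneous m → (φ p).IsHomogeneous (c + m)) (m : ℕ) (p : MvPolynomial σ k) :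
    homogeneousComponent (c + m) (φ p) = φ (homogeneousComponent m p) := by
  rw [← sum_homogeneousComponent p]
  simp only [map_sum]
  refine Finset.sum_congr rfl fun i _ => ?_
  have hi := homogeneousComponent_isHomogeneous i p
  rw [homogeneousComponent_of_mem (hφ i _ hi), homogeneousComponent_of_mem hi,
    apply_ite φ, map_zero]
  simp only [add_right_inj]

variable {G : Type v} [Group G] {V : Type w} [AddCommGroup V] [Module k V] {ι : Type} [Fintype ι]
  (b : Module.Basis ι k V) (ρ : Representation k G V)

theorem polyAction_X (g : G) (i : ι) :
    polyAction b ρ g (X i) = ∑ j, C (b.repr (ρ g (b i)) j) * X j := aeval_X _ _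

theorem polyAction_one : polyAction b ρ 1 = AlgHom.id k _ := by
  classical
  ext i : 1
  rw [polyAction_X, map_one, Module.End.one_apply, Module.Basis.repr_self,
    Finset.sum_eq_single i]
  · simp
  · intro j _ hj
    simp [hj.symm]
  · simp

theorem polyAction_mul (g h : G) :
    polyAction b ρ (g * h) = (polyAction b ρ g).comp (polyAction b ρ h) := by
  ext i : 1
  rw [AlgHom.comp_apply, polyAction_X, polyAction_X, map_mul, Module.End.mul_apply]
  simp only [map_sum, map_mul, polyAction_X, algHom_C]
  conv_lhs => rw [← b.sum_repr (ρ h (b i))]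
  simp only [map_sum, map_smul, Finsupp.coe_finsetSum, Finset.sum_apply, Finsupp.smul_apply,
    smul_eq_mul, Finset.sum_mul, Finset.mul_sum, map_mul]
  rw [Finset.sum_comm]
  refine Finset.sum_congr rfl fun j _ => Finset.sum_congr rfl fun l _ => ?_
  simp only [algebraMap_eq, mul_assoc]

/-- The action of `G` on `k[V]`, as a homomorphism to the group of automorphisms. -/
def polyActionHom : G →* (MvPolynomial ι k ≃ₐ[k] MvPolynomial ι k) where
  toFun g := AlgEquiv.ofAlgHom (polyAction b ρ g) (polyAction b ρ g⁻¹)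
    (by rw [← polyAction_mul, mul_inv_cancel, polyAction_one])
    (by rw [← polyAction_mul, inv_mul_cancel, polyAction_one])
  map_one' := AlgEquiv.ext fun x => DFunLike.congr_fun (polyAction_one b ρ) x
  map_mul' g h := AlgEquiv.ext fun x => DFunLike.congr_fun (polyAction_mul b ρ g h) x

theorem isHomogeneous_polyAction (g : G) {m : ℕ} {p : MvPolynomial ι k}
    (hp : p.IsHomogeneous m) : (polyAction b ρ g p).IsHomogeneous m := by
  have := hp.aeval (fun i => ∑ j, C (b.repr (ρ g (b i)) j) * X j) (n := 1) fun i =>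
    IsHomogeneous.sum _ _ _ fun j _ => isHomogeneous_C_mul_X _ _
  rwa [one_mul] at this

variable {b ρ}

theorem mem_invariantRing {p : MvPolynomial ι k} :
    p ∈ invariantRing b ρ ↔ ∀ g, polyAction b ρ g p = p := by
  rw [invariantRing, Algebra.mem_iInf]
  rfl

theorem mem_invariantPiece {n : ℕ} {x : invariantRing b ρ} :
    x ∈ invariantPiece b ρ n ↔ (x : MvPolynomial ι k).IsHomogeneous n := Iff.rfl

theorem homogeneousComponent_mem_invariantRing {p : MvPolynomial ι k}
    (hp : p ∈ invariantRing b ρ) (m : ℕ) : homogeneousComponent m p ∈ invariantRing b ρ := by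
  refine mem_invariantRing.2 fun g => ?_
  have hφ := homogeneousComponent_map_of_isHomogeneous (c := 0)
    (φ := (polyAction b ρ g : MvPolynomial ι k →+ MvPolynomial ι k))
    (fun i q hq => by
      rw [zero_add]
      exact isHomogeneous_polyAction b ρ g hq) m p
  rw [zero_add] at hφ
  exact hφ.symm.trans (congrArg _ (mem_invariantRing.1 hp g))

theorem isSplitInvariants_of_card_ne_zero [Finite G] (h : (Nat.card G : k) ≠ 0) :
    IsSplitInvariants b ρ := by
  have := Fintype.ofFinite G
  have hmem (x : MvPolynomial ι k) :
      (Nat.card G : k)⁻¹ • ∑ g : G, polyAction b ρ g x ∈ invariantRing b ρ := by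
    refine mem_invariantRing.2 fun g => ?_
    have hsum : ∑ g' : G, polyAction b ρ g (polyAction b ρ g' x) = ∑ g' : G, polyAction b ρ g' x :=
      Fintype.sum_equiv (Equiv.mulLeft g) _ _ fun g' => by
        rw [Equiv.coe_mulLeft, polyAction_mul, AlgHom.comp_apply]
    rw [map_smul, map_sum, hsum]
  refine ⟨{ toFun := fun x => ⟨_, hmem x⟩, map_add' := fun x y => Subtype.ext ?_,
            map_smul' := fun r x => Subtype.ext ?_ }, fun x => Subtype.ext ?_⟩
  · simp only [map_add, Finset.sum_add_distrib, smul_add, Subalgebra.coe_add]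
  · simp only [Subalgebra.smul_def, smul_eq_mul, map_mul, mem_invariantRing.1 r.2,
      ← Finset.mul_sum, RingHom.id_apply, Subalgebra.coe_mul, mul_smul_comm]
  · simp only [LinearMap.coe_mk, AddHom.coe_mk, mem_invariantRing.1 x.2, Finset.sum_const,
      Finset.card_univ, ← Nat.card_eq_fintype_card]
    rw [← Nat.cast_smul_eq_nsmul k, inv_smul_smul₀ h]

/-- The part of degree zero of an endomorphism `ψ` of the polynomial ring: on forms of degree `m`,
the component of degree `m` of `ψ`. -/
def degreeZeroPart {σ : Type*} (ψ : MvPolynomial σ k →ₗ[k] MvPolynomial σ k) :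
    MvPolynomial σ k →ₗ[k] MvPolynomial σ k :=
  (basisMonomials σ k).constr k fun s => homogeneousComponent s.degree (ψ (monomial s 1))

section DegreeZeroPart

variable {σ : Type*} {ψ : MvPolynomial σ k →ₗ[k] MvPolynomial σ k}

theorem degreeZeroPart_monomial (s : σ →₀ ℕ) (c : k) :
    degreeZeroPart ψ (monomial s c) = homogeneousComponent s.degree (ψ (monomial s c)) := by
  have hc : (monomial s c : MvPolynomial σ k) = c • basisMonomials σ k s := by
    rw [coe_basisMonomials, smul_monomial, smul_eq_mul, mul_one]
  rw [hc, map_smul, degreeZeroPart, Module.Basis.constr_basis, map_smul, map_smul,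
    coe_basisMonomials]

theorem degreeZeroPart_of_isHomogeneous {m : ℕ} {p : MvPolynomial σ k} (hp : p.IsHomogeneous m) :
    degreeZeroPart ψ p = homogeneousComponent m (ψ p) := by
  rw [p.as_sum]
  simp only [map_sum]
  refine Finset.sum_congr rfl fun s hs => ?_
  rw [degreeZeroPart_monomial, hp.degree_eq_sum_deg_support hs]
  rfl

theorem degreeZeroPart_eq_sum (p : MvPolynomial σ k) : degreeZeroPart ψ p =
    ∑ m ∈ Finset.range (p.totalDegree + 1),
      homogeneousComponent m (ψ (homogeneousComponent m p)) := by
  conv_lhs => rw [← sum_homogeneousComponent p, map_sum]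
  exact Finset.sum_congr rfl fun m _ =>
    degreeZeroPart_of_isHomogeneous (homogeneousComponent_isHomogeneous m p)

theorem degreeZeroPart_mul_of_isHomogeneous {i : ℕ} {r : MvPolynomial σ k}
    (hr : r.IsHomogeneous i) (hψ : ∀ p, ψ (r * p) = r * ψ p) (p : MvPolynomial σ k) :
    degreeZeroPart ψ (r * p) = r * degreeZeroPart ψ p := by
  rw [degreeZeroPart_eq_sum p, Finset.mul_sum]
  conv_lhs => rw [← sum_homogeneousComponent p, Finset.mul_sum, map_sum]
  refine Finset.sum_congr rfl fun j _ => ?_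
  rw [degreeZeroPart_of_isHomogeneous (hr.mul (homogeneousComponent_isHomogeneous j p)), hψ]
  exact homogeneousComponent_map_of_isHomogeneous (φ := AddMonoidHom.mulLeft r)
    (fun m q hq => hr.mul hq) j _

end DegreeZeroPart

theorem IsSplitInvariants.exists_graded (h : IsSplitInvariants b ρ) :
    ∃ π : MvPolynomial ι k →ₗ[invariantRing b ρ] invariantRing b ρ,
      (∀ x : invariantRing b ρ, π (x : MvPolynomial ι k) = x) ∧
      ∀ m p, p.IsHomogeneous m → π p ∈ invariantPiece b ρ m := by
  obtain ⟨π, hπ⟩ := h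
  let ψ : MvPolynomial ι k →ₗ[k] MvPolynomial ι k :=
    (invariantRing b ρ).val.toLinearMap ∘ₗ π.restrictScalars k
  have hmem (p) : degreeZeroPart ψ p ∈ invariantRing b ρ := by
    rw [degreeZeroPart_eq_sum]
    exact sum_mem fun m _ => homogeneousComponent_mem_invariantRing (π _).2 m
  have hmul (r : invariantRing b ρ) (p) : degreeZeroPart ψ (r * p) = r * degreeZeroPart ψ p := by
    rw [← sum_homogeneousComponent (r : MvPolynomial ι k)]
    simp only [Finset.sum_mul, map_sum]
    refine Finset.sum_congr rfl fun i _ => degreeZeroPart_mul_of_isHomogeneous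
      (homogeneousComponent_isHomogeneous i _) (fun p => ?_) p
    exact congrArg Subtype.val
      (π.map_smul ⟨_, homogeneousComponent_mem_invariantRing r.2 i⟩ p)
  refine ⟨{ toFun := fun p => ⟨degreeZeroPart ψ p, hmem p⟩,
            map_add' := fun p q => Subtype.ext (map_add _ p q),
            map_smul' := fun r p => Subtype.ext (hmul r p) }, fun x => Subtype.ext ?_,
          fun m p hp => ?_⟩
  · change degreeZeroPart ψ x = x
    conv_rhs => rw [← sum_homogeneousComponent (x : MvPolynomial ι k)]
    rw [degreeZeroPart_eq_sum]
    refine Finset.sum_congr rfl fun m _ => ?_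
    rw [show ψ (homogeneousComponent m x) = homogeneousComponent m x from congrArg Subtype.val
      (hπ ⟨_, homogeneousComponent_mem_invariantRing x.2 m⟩)]
    rw [homogeneousComponent_of_mem (homogeneousComponent_isHomogeneous m _), if_pos rfl]
  · rw [mem_invariantPiece]
    change (degreeZeroPart ψ p).IsHomogeneous m
    rw [degreeZeroPart_of_isHomogeneous hp]
    exact homogeneousComponent_isHomogeneous _ _

theorem homogeneousSubmodule_mul_homogeneousSubmodule {σ : Type*} (m n : ℕ) :
    homogeneousSubmodule σ k m * homogeneousSubmodule σ k n = homogeneousSubmodule σ k (m + n) := by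
  rw [← homogeneousSubmodule_one_pow _ m, ← homogeneousSubmodule_one_pow _ n, ← pow_add,
    homogeneousSubmodule_one_pow]

theorem homogeneousSubmodule_card_le {σ H : Type*} [Fintype H]
    {N : Submodule k (MvPolynomial σ k)}
    (hN : ∀ f : H → MvPolynomial σ k, (∀ h, (f h).IsHomogeneous 1) → ∏ h, f h ∈ N) :
    homogeneousSubmodule σ k (Fintype.card H) ≤ N := by
  rw [← homogeneousSubmodule_one_pow, Submodule.pow_eq_span_pow_set, Submodule.span_le]
  intro p hp
  obtain ⟨f, rfl⟩ := Set.mem_pow.1 hp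
  rw [List.prod_ofFn, ← (Fintype.equivFin H).prod_comp]
  exact hN _ fun h => (f _).2

theorem mem_hilbertIdeal_of_le {m n : ℕ}
    (hm : ∀ p : MvPolynomial ι k, p.IsHomogeneous m → p ∈ hilbertIdeal b ρ) (hmn : m ≤ n)
    {p : MvPolynomial ι k} (hp : p.IsHomogeneous n) : p ∈ hilbertIdeal b ρ := by
  rw [← mem_homogeneousSubmodule, ← Nat.sub_add_cancel hmn,
    ← homogeneousSubmodule_mul_homogeneousSubmodule] at hp
  exact Submodule.mul_induction_on hp (fun x _ y hy => Ideal.mul_mem_left _ _ (hm y hy))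
    fun _ _ => add_mem

instance : SMulCommClass (polyActionHom b ρ).range (invariantRing b ρ) (MvPolynomial ι k) where
  smul_comm := by
    rintro ⟨_, g, rfl⟩ r p
    change polyAction b ρ g (r * p) = r * polyAction b ρ g p
    rw [map_mul, mem_invariantRing.1 r.2]

instance :
    Algebra.IsInvariant (invariantRing b ρ) (MvPolynomial ι k) (polyActionHom b ρ).range where
  isInvariant p hp := ⟨⟨p, mem_invariantRing.2 fun g => hp ⟨_, g, rfl⟩⟩, rfl⟩

theorem prod_mem_hilbertIdeal [Fintype (polyActionHom b ρ).range] (h : IsSplitInvariants b ρ)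
    {f : (polyActionHom b ρ).range → MvPolynomial ι k} (hf : ∀ g, (f g).IsHomogeneous 1) :
    ∏ g, f g ∈ hilbertIdeal b ρ := by
  obtain ⟨π, hπ, hπm⟩ := h.exists_graded
  refine prod_mem_of_forall_algebraMap_mem π (hπ 1) fun t ht =>
    Ideal.subset_span ⟨(π _).2, t.card, ht.card_pos, hπm _ _ ?_⟩
  have hg : ∀ g ∈ t, (g • f g).IsHomogeneous 1 := by
    rintro ⟨_, g, rfl⟩ -
    exact isHomogeneous_polyAction b ρ g (hf _)
  simpa only [Finset.sum_const, smul_eq_mul, mul_one] using IsHomogeneous.prod t _ (fun _ => 1) hg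

theorem mem_hilbertIdeal_of_isHomogeneous_card [Finite G] (h : IsSplitInvariants b ρ)
    {p : MvPolynomial ι k} (hp : p.IsHomogeneous (Nat.card G)) : p ∈ hilbertIdeal b ρ := by
  have : Finite (polyActionHom b ρ).range := Set.finite_range (polyActionHom b ρ)
  have := Fintype.ofFinite (polyActionHom b ρ).range
  have hcard : Fintype.card (polyActionHom b ρ).range ≤ Nat.card G := by
    rw [← Nat.card_eq_fintype_card]
    exact Nat.card_le_card_of_surjective _ (polyActionHom b ρ).rangeRestrict_surjective
  have hle := homogeneousSubmodule_card_le (N := (hilbertIdeal b ρ).restrictScalars k)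
    fun _ hf => prod_mem_hilbertIdeal h hf
  exact mem_hilbertIdeal_of_le (fun q hq => hle hq) hcard hp

theorem tau_spec [Finite G] (h : IsSplitInvariants b ρ) : 0 < tau b ρ ∧
    ∀ p : MvPolynomial ι k, p.IsHomogeneous (tau b ρ) → p ∈ hilbertIdeal b ρ :=
  Nat.sInf_mem (s := {m | 0 < m ∧ ∀ p : MvPolynomial ι k, p.IsHomogeneous m →
      p ∈ hilbertIdeal b ρ})
    ⟨Nat.card G, Nat.card_pos, fun _ hp => mem_hilbertIdeal_of_isHomogeneous_card h hp⟩

theorem tau_le_card [Finite G] (h : IsSplitInvariants b ρ) : tau b ρ ≤ Nat.card G :=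
  Nat.sInf_le ⟨Nat.card_pos, fun _ hp => mem_hilbertIdeal_of_isHomogeneous_card h hp⟩

theorem intGrading_le_hilbertIdeal [Finite G] (h : IsSplitInvariants b ρ) (m : ℤ)
    (hm : tau b ρ ≤ m) :
    intGrading (homogeneousSubmodule ι k) m ≤ (hilbertIdeal b ρ).toAddSubgroup := by
  obtain ⟨m, rfl⟩ := Int.eq_ofNat_of_zero_le ((Int.natCast_nonneg _).trans hm)
  exact fun p hp => mem_hilbertIdeal_of_le (tau_spec h).2 (Int.ofNat_le.1 hm) hp

theorem isInternal_homogeneousSubmodule (σ : Type*) :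
    DirectSum.IsInternal (homogeneousSubmodule σ k) :=
  isInternal_weightedHomogeneousSubmodule 1

instance : SetLike.GradedMonoid (invariantPiece b ρ) where
  one_mem := isHomogeneous_one ι k
  mul_mem _ _ _ _ hx hy := IsHomogeneous.mul hx hy

theorem iSupIndep_intGrading_invariantPiece : iSupIndep (intGrading (invariantPiece b ρ)) :=
  iSupIndep_of_forall_map_mem (J := Unit) (ψ := fun _ => (invariantRing b ρ).subtype.toAddMonoidHom)
    (fun _ hy => Subtype.ext (hy ()))
    (fun _ => iSupIndep_intGrading (isInternal_homogeneousSubmodule ι))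
    fun _ => forall_mem_of_natCast intGrading_eq_bot fun _ _ hy => hy

theorem aeval_mem_of_isWeightedHomogeneous {σ A : Type*} [CommRing A] [Algebra k A]
    {𝒜 : ℕ → Submodule k A} [SetLike.GradedMonoid 𝒜] {f : σ → A} {e : σ → ℕ}
    (hf : ∀ j, f j ∈ 𝒜 (e j)) {m : ℕ} {q : MvPolynomial σ k} (hq : q.IsWeightedHomogeneous e m) :
    aeval f q ∈ 𝒜 m := by
  rw [q.as_sum, map_sum]
  refine sum_mem fun s hs => ?_
  rw [aeval_monomial, ← Algebra.smul_def, ← hq (mem_support_iff.1 hs), Finsupp.weight_apply]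
  exact Submodule.smul_mem _ _
    (SetLike.prod_mem_graded _ _ _ fun j _ => SetLike.pow_mem_graded _ (hf j))

namespace IsMinimalGenerators

variable {r : ℕ} {f : Fin r → invariantRing b ρ} {e : Fin r → ℕ}

theorem notMem_adjoin (hf : IsMinimalGenerators b ρ f e) (j : Fin r) :
    f j ∉ Algebra.adjoin k (f '' {j}ᶜ) := by
  refine fun h => hf.minimal j (top_le_iff.1 (hf.generates ▸ Algebra.adjoin_le ?_))
  rintro _ ⟨i, rfl⟩
  by_cases hij : i = j
  · exact hij ▸ h
  · exact Algebra.subset_adjoin ⟨i, hij, rfl⟩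

theorem degree_pos (hf : IsMinimalGenerators b ρ f e) (j : Fin r) : 0 < e j := by
  refine Nat.pos_of_ne_zero fun h => hf.notMem_adjoin j ?_
  have hj := hf.homogeneous j
  rw [h, mem_invariantPiece, ← mem_homogeneousSubmodule, homogeneousSubmodule_zero,
    Submodule.mem_one] at hj
  obtain ⟨c, hc⟩ := hj
  rw [show f j = algebraMap k _ c from Subtype.ext hc.symm]
  exact Subalgebra.algebraMap_mem _ c

theorem isKoszulResolution (hf : IsMinimalGenerators b ρ f e) :
    Koszul.IsKoszulResolution (intGrading (weightedHomogeneousSubmodule k e)) (fun j => (e j : ℤ))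
      X (List.finRange r) :=
  isKoszulResolution_X hf.degree_pos List.mem_finRange (List.nodup_finRange r)

theorem exists_aeval_eq (hf : IsMinimalGenerators b ρ f e) {m : ℕ} {x : invariantRing b ρ}
    (hx : x ∈ invariantPiece b ρ m) :
    ∃ q : MvPolynomial (Fin r) k, q.IsWeightedHomogeneous e m ∧ aeval f q = x := by
  obtain ⟨q, rfl⟩ : x ∈ (aeval f : MvPolynomial (Fin r) k →ₐ[k] _).range := by
    rw [← Algebra.adjoin_range_eq_range_aeval, hf.generates]
    trivial
  exact exists_mem_map_eq (P := intGrading (weightedHomogeneousSubmodule k e))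
    (P' := intGrading (invariantPiece b ρ)) (n := m)
    (φ := (aeval f : MvPolynomial (Fin r) k →ₐ[k] invariantRing b ρ))
    (iSup_intGrading (isInternal_weightedHomogeneousSubmodule e).submodule_iSup_eq_top)
    iSupIndep_intGrading_invariantPiece
    (forall_mem_of_natCast intGrading_eq_bot fun _ _ hq =>
      aeval_mem_of_isWeightedHomogeneous hf.homogeneous hq) hx

theorem mem_adjoin_of_lt (hf : IsMinimalGenerators b ρ f e) {m : ℕ} {x : invariantRing b ρ}
    (hx : x ∈ invariantPiece b ρ m) {j : Fin r} (hj : m < e j) :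
    x ∈ Algebra.adjoin k (f '' {j}ᶜ) := by
  obtain ⟨q, hq, rfl⟩ := hf.exists_aeval_eq hx
  rw [q.as_sum, map_sum]
  refine sum_mem fun s hs => ?_
  rw [aeval_monomial]
  refine mul_mem (Subalgebra.algebraMap_mem _ _) (prod_mem fun i hi => pow_mem ?_ _)
  refine Algebra.subset_adjoin ⟨i, ?_, rfl⟩
  rintro rfl
  rw [← hq (mem_support_iff.1 hs)] at hj
  exact hj.not_ge (Finsupp.le_weight_of_ne_zero' e (Finsupp.mem_support_iff.1 hi))

theorem hilbertIdeal_eq_span (hf : IsMinimalGenerators b ρ f e) :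
    hilbertIdeal b ρ = Ideal.span (Set.range fun j => (f j : MvPolynomial ι k)) := by
  refine le_antisymm (Ideal.span_le.2 ?_) (Ideal.span_le.2 ?_)
  · rintro p ⟨hp, m, hm, hpm⟩
    obtain ⟨q, hq, hqp⟩ := hf.exists_aeval_eq (x := ⟨p, hp⟩) hpm
    have hq' := hf.isKoszulResolution.positiveIdeal_le (Ideal.subset_span ⟨m, hm, hq⟩)
    have hmap := Ideal.mem_map_of_mem ((invariantRing b ρ).val.comp (aeval f)) hq'
    rw [AlgHom.comp_apply, hqp, Ideal.map_span, Set.image_image] at hmap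
    refine Ideal.span_mono ?_ hmap
    rintro _ ⟨j, -, rfl⟩
    exact ⟨j, (congrArg Subtype.val (aeval_X f j)).symm⟩
  · rintro _ ⟨j, rfl⟩
    exact Ideal.subset_span ⟨(f j).2, e j, hf.degree_pos j, hf.homogeneous j⟩

theorem range_linearCombination (hf : IsMinimalGenerators b ρ f e) :
    LinearMap.range (Finsupp.linearCombination (MvPolynomial ι k)
      fun j => (f j : MvPolynomial ι k)) = hilbertIdeal b ρ := by
  rw [Finsupp.range_linearCombination, hf.hilbertIdeal_eq_span]

theorem exists_linearCombination_eq (hf : IsMinimalGenerators b ρ f e) {m : ℕ}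
    {p : MvPolynomial ι k} (hp : p.IsHomogeneous m) (hpI : p ∈ hilbertIdeal b ρ) :
    ∃ g ∈ freeGrading (intGrading (homogeneousSubmodule ι k)) (fun j => (e j : ℤ)) m,
      Finsupp.linearCombination (MvPolynomial ι k) (fun j => (f j : MvPolynomial ι k)) g = p := by
  rw [← hf.range_linearCombination] at hpI
  obtain ⟨g, rfl⟩ := hpI
  have hB := isInternal_homogeneousSubmodule (k := k) ι
  exact exists_mem_map_eq (P' := intGrading (homogeneousSubmodule ι k))
    (φ := (Finsupp.linearCombination (MvPolynomial ι k) _).toAddMonoidHom)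
    (iSup_freeGrading (iSup_intGrading hB.submodule_iSup_eq_top)) (iSupIndep_intGrading hB)
    (fun _ _ hg => linearCombination_mem (P := intGrading (homogeneousSubmodule ι k))
      (fun j => hf.homogeneous j) hg) hp

/-- If `e j` exceeds `τ`, then `f j` is a sum of products `x * y` with `y` of degree `τ`, hence in
the Hilbert ideal; the splitting turns these into polynomials in the generators of smaller
degree. -/
theorem degree_le_tau [Finite G] (hf : IsMinimalGenerators b ρ f e)
    (h : IsSplitInvariants b ρ) (j : Fin r) : e j ≤ tau b ρ := by
  by_contra! hj
  obtain ⟨π, hπ, hπm⟩ := h.exists_graded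
  refine hf.notMem_adjoin j ?_
  rw [← hπ (f j)]
  have hmem : (f j : MvPolynomial ι k) ∈
      homogeneousSubmodule ι k (e j - tau b ρ) * homogeneousSubmodule ι k (tau b ρ) := by
    rw [homogeneousSubmodule_mul_homogeneousSubmodule, Nat.sub_add_cancel hj.le]
    exact hf.homogeneous j
  refine Submodule.mul_induction_on hmem (fun x hx y hy => ?_) fun x y hx hy => by
    rw [map_add]
    exact add_mem hx hy
  obtain ⟨g, hg, rfl⟩ := hf.exists_linearCombination_eq hy ((tau_spec h).2 y hy)
  rw [Finsupp.linearCombination_apply, Finsupp.sum, Finset.mul_sum, map_sum]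
  refine sum_mem fun i _ => ?_
  rw [smul_eq_mul, ← mul_assoc, mul_comm, ← smul_eq_mul, ← Subalgebra.smul_def, map_smul,
    smul_eq_mul]
  by_cases hgi0 : g i = 0
  · rw [hgi0, mul_zero, map_zero, mul_zero]
    exact zero_mem _
  have hi := hf.degree_pos i
  have hgi := mem_freeGrading.1 hg i
  have hle : e i ≤ tau b ρ := by
    by_contra! hlt
    rw [intGrading_eq_bot _ (by lia)] at hgi
    exact hgi0 hgi
  rw [← Nat.cast_sub hle, mem_intGrading_natCast] at hgi
  refine mul_mem (Algebra.subset_adjoin ⟨i, ?_, rfl⟩)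
    (hf.mem_adjoin_of_lt (hπm _ _ (IsHomogeneous.mul hx hgi)) (by lia))
  rintro rfl
  exact hj.not_ge hle

end IsMinimalGenerators

theorem homogeneousComponent_mem_hilbertIdeal {p : MvPolynomial ι k} (hp : p ∈ hilbertIdeal b ρ)
    (m : ℕ) : homogeneousComponent m p ∈ hilbertIdeal b ρ := by
  let := gradedAlgebra (σ := ι) (R := k)
  exact (mem_iff_homogeneousComponent_mem
    (Ideal.homogeneous_span _ _ fun _ hp => hp.2.imp fun _ hm => hm.2) p).1 hp m

theorem iSup_hilbertIdealPiece : ⨆ m, hilbertIdealPiece b ρ m = ⊤ := by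
  refine eq_top_iff.2 fun p _ => ?_
  have hp : p = ∑ m ∈ Finset.range ((p : MvPolynomial ι k).totalDegree + 1),
      ⟨_, homogeneousComponent_mem_hilbertIdeal p.2 m⟩ := by
    refine Subtype.ext ?_
    rw [AddSubmonoidClass.coe_finsetSum]
    exact (sum_homogeneousComponent _).symm
  rw [hp]
  exact sum_mem fun m _ => Submodule.mem_iSup_of_mem m (homogeneousComponent_isHomogeneous m _)

theorem intGrading_hilbertIdealPiece : intGrading (hilbertIdealPiece b ρ) =
    subGrading (intGrading (homogeneousSubmodule ι k)) (hilbertIdeal b ρ) := by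
  funext m
  match m with
  | .ofNat _ => rfl
  | .negSucc _ => exact (subGrading_eq_bot rfl).symm

instance : SetLike.GradedSMul (homogeneousSubmodule ι k) (hilbertIdealPiece b ρ) where
  smul_mem _ _ _ _ hp hq := IsHomogeneous.mul hp hq

theorem iSupIndep_intGrading_hilbertIdealPiece : iSupIndep (intGrading (hilbertIdealPiece b ρ)) :=
  intGrading_hilbertIdealPiece (b := b) (ρ := ρ) ▸
    iSupIndep_subGrading (iSupIndep_intGrading (isInternal_homogeneousSubmodule ι))

theorem hilbertIdeal_le_ker_constantCoeff :
    hilbertIdeal b ρ ≤ RingHom.ker (constantCoeff (σ := ι) (R := k)) := by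
  refine Ideal.span_le.2 ?_
  rintro p ⟨-, m, hm, hp⟩
  refine RingHom.mem_ker.2 (hp.coeff_eq_zero ?_)
  rw [map_zero]
  exact hm.ne

theorem subGrading_hilbertIdeal_eq_bot : ∀ m < 1,
    subGrading (intGrading (homogeneousSubmodule ι k)) (hilbertIdeal b ρ) m = ⊥ := by
  intro m hm
  rcases (show m ≤ 0 by lia).lt_or_eq with hm | rfl
  · exact subGrading_eq_bot (intGrading_eq_bot m hm)
  refine (AddSubgroup.eq_bot_iff_forall _).2 fun p hp => Subtype.ext ?_
  have hp0 : (p : MvPolynomial ι k) ∈ homogeneousSubmodule ι k 0 := hp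
  rw [homogeneousSubmodule_zero, Submodule.mem_one] at hp0
  obtain ⟨c, hc⟩ := hp0
  have hc0 := RingHom.mem_ker.1 (hilbertIdeal_le_ker_constantCoeff p.2)
  rw [← hc, algebraMap_eq, constantCoeff_C] at hc0
  rw [← hc, hc0, map_zero]
  rfl

variable (b ρ) in
/-- The vanishing of `Tor_s(I, k)` in degree `d`, where `I` is the Hilbert ideal, computed by the
Koszul complex of the variables. -/
def HilbertIdealAcyclic (s : ℕ) (d : ℤ) : Prop :=
  Koszul.Acyclic (fun _ => 1) (subGrading (intGrading (homogeneousSubmodule ι k))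
    (hilbertIdeal b ρ)) (X : ι → MvPolynomial ι k) Finset.univ.toList s d

theorem isKoszulResolution_X_one : Koszul.IsKoszulResolution
    (intGrading (homogeneousSubmodule ι k)) (fun _ => 1) X Finset.univ.toList :=
  isKoszulResolution_X (e := 1) (fun _ => Nat.one_pos)
    (fun _ => Finset.mem_toList.2 (Finset.mem_univ _)) (Finset.nodup_toList _)

theorem hilbertIdealAcyclic_of_add_lt [Finite G] (h : IsSplitInvariants b ρ) (s : ℕ) (d : ℤ)
    (hd : tau b ρ + s < d) : HilbertIdealAcyclic b ρ s d :=
  isKoszulResolution_X_one.acyclic_subGrading (fun _ => le_rfl) (Int.natCast_nonneg _)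
    (intGrading_le_hilbertIdeal h) s d hd

theorem hilbertIdealAcyclic_one {d : ℕ} (h : hilbertIdealTorEnd b ρ 1 < d) :
    HilbertIdealAcyclic b ρ 1 d := by
  rw [HilbertIdealAcyclic, ← intGrading_hilbertIdealPiece]
  exact acyclic_one_of_torEnd_lt (ℳ := hilbertIdealPiece b ρ) isKoszulResolution_X_one
    (isInternal_homogeneousSubmodule ι) iSupIndep_intGrading_hilbertIdealPiece
    iSup_hilbertIdealPiece h

theorem card_le_one_of_hilbertIdealAcyclic [Finite G] (h : IsSplitInvariants b ρ)
    (hτ : tau b ρ = 1) (h1 : HilbertIdealAcyclic b ρ 1 2) : Fintype.card ι ≤ 1 := by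
  rw [← Finset.card_univ, ← Finset.length_toList]
  have hX (j : ι) : X j ∈ hilbertIdeal b ρ := (tau_spec h).2 _ (hτ ▸ isHomogeneous_X k j)
  exact Koszul.length_le_one_of_acyclic (y := fun j => ⟨X j, hX j⟩) subGrading_hilbertIdeal_eq_bot
    (fun j => isHomogeneous_X k j) (fun j hj => X_ne_zero j (congrArg Subtype.val hj))
    (fun i j => Subtype.ext (mul_comm (X i) (X j))) h1

theorem hilbertIdealAcyclic_of_max_mul_lt [Finite G] (h : IsSplitInvariants b ρ)
    (h1 : hilbertIdealTorEnd b ρ 1 ≤ tau b ρ) (s : ℕ) (d : ℤ) (hd : (max 1 s : ℕ) * tau b ρ < d) :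
    HilbertIdealAcyclic b ρ s d := by
  have hone (d : ℤ) (hd : tau b ρ < d) : HilbertIdealAcyclic b ρ 1 d := by
    lift d to ℕ using (Int.natCast_nonneg _).trans hd.le
    exact hilbertIdealAcyclic_one (h1.trans_lt (by exact_mod_cast hd))
  match s with
  | 0 => exact hilbertIdealAcyclic_of_add_lt h 0 d (by simpa using hd)
  | 1 => exact hone d (by simpa using hd)
  | s + 2 =>
    rw [max_eq_right (Nat.le_add_left 1 _)] at hd
    rcases (Nat.succ_le_of_lt (tau_spec h).1).eq_or_lt' with hτ | hτ
    · refine Koszul.acyclic_of_length_lt ?_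
      rw [Finset.length_toList, Finset.card_univ]
      have := card_le_one_of_hilbertIdealAcyclic h hτ (hone 2 (by rw [hτ]; norm_num))
      lia
    · refine hilbertIdealAcyclic_of_add_lt h _ d (lt_of_le_of_lt ?_ hd)
      push_cast
      nlinarith

/-- The splitting makes the Koszul complex of the generators over `R` a retract of the one over
`k[V]`. -/
theorem invariantTorEnd_le_of_acyclic {r : ℕ} {f : Fin r → invariantRing b ρ} {e : Fin r → ℕ}
    (h : IsSplitInvariants b ρ) (hf : IsMinimalGenerators b ρ f e) {i : ℕ} {c : ℝ}
    (hc : ∀ d : ℕ, c < d → Koszul.Acyclic (fun j => (e j : ℤ))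
      (intGrading (homogeneousSubmodule ι k)) (fun j => (f j : MvPolynomial ι k))
      (List.finRange r) i d) :
    invariantTorEnd b ρ f e i ≤ c := by
  let : Module (MvPolynomial (Fin r) k) (invariantRing b ρ) := Module.compHom _
    (aeval f : MvPolynomial (Fin r) k →ₐ[k] invariantRing b ρ).toRingHom
  have hX (j : Fin r) (x : invariantRing b ρ) :
      (X j : MvPolynomial (Fin r) k) • x = f j * x := congrArg (· * x) (aeval_X f j)
  obtain ⟨π, hπ, hπm⟩ := h.exists_graded
  have := WeightedHomogeneousSubmodule.gradedMonoid (R := k) (w := e)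
  refine torEnd_le_of_acyclic hf.isKoszulResolution (isInternal_weightedHomogeneousSubmodule e)
    iSupIndep_intGrading_invariantPiece fun d hd => (hc d hd).of_retract
      (ι := (invariantRing b ρ).subtype.toAddMonoidHom) (π := π.toAddMonoidHom) hπ
      (fun j x => ?_) (fun j p => ?_)
      (forall_mem_of_natCast intGrading_eq_bot fun _ _ hx => hx)
      (forall_mem_of_natCast intGrading_eq_bot hπm)
  · rw [hX]
    rfl
  · rw [hX]
    exact π.map_smul (f j) p

theorem invariantTorEnd_le [Finite G] {r : ℕ} {f : Fin r → invariantRing b ρ} {e : Fin r → ℕ}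
    (h : IsSplitInvariants b ρ) (hf : IsMinimalGenerators b ρ f e) {t : ℕ → ℤ} (ht : Monotone t)
    (ht0 : tau b ρ ≤ t 0) (hI : ∀ (s : ℕ) d, t s < d → HilbertIdealAcyclic b ρ s d)
    {β : ℕ → ℤ} (hβ : ∀ q : ℕ, (q + 1) * (tau b ρ : ℤ) ≤ β q)
    (hβt : ∀ p q, p < q → β p + t (q - p) ≤ β q) (i : ℕ) :
    invariantTorEnd b ρ f e i ≤ ((β i - 1 : ℝ) : EReal) := by
  have hB := isInternal_homogeneousSubmodule (k := k) ι
  refine invariantTorEnd_le_of_acyclic h hf fun d hd =>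
    isKoszulResolution_X_one.acyclic_of_generators (iSupIndep_intGrading hB)
      (iSup_intGrading hB.submodule_iSup_eq_top) List.mem_finRange hf.homogeneous
      (fun _ => Int.natCast_nonneg _) (fun j => Int.ofNat_le.2 (hf.degree_le_tau h j))
      hf.range_linearCombination (intGrading_le_hilbertIdeal h) ht ht0 hI hβ hβt i ?_
  exact Int.sub_one_lt_iff.1 (by exact_mod_cast hd)

theorem invariantTorEnd_le_mul_add [Finite G] {r : ℕ} {f : Fin r → invariantRing b ρ}
    {e : Fin r → ℕ} (h : IsSplitInvariants b ρ) (hf : IsMinimalGenerators b ρ f e) (i : ℕ) :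
    invariantTorEnd b ρ f e i ≤ ((((i : ℝ) + 1) * tau b ρ + i - 1 : ℝ) : EReal) := by
  have hi := invariantTorEnd_le h hf (t := fun s => tau b ρ + s)
    (β := fun q => (q + 1) * tau b ρ + q)
    (fun _ _ hs => add_le_add_right (Nat.cast_le.2 hs) _) (by simp)
    (hilbertIdealAcyclic_of_add_lt h) (fun q => by simp)
    (fun p q hpq => by push_cast [hpq.le]; nlinarith) i
  exact_mod_cast hi

theorem invariantTorEnd_le_mul [Finite G] {r : ℕ} {f : Fin r → invariantRing b ρ} {e : Fin r → ℕ}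
    (h : IsSplitInvariants b ρ) (hf : IsMinimalGenerators b ρ f e)
    (h1 : hilbertIdealTorEnd b ρ 1 ≤ tau b ρ) (i : ℕ) :
    invariantTorEnd b ρ f e i ≤ ((((i : ℝ) + 1) * tau b ρ - 1 : ℝ) : EReal) := by
  have hi := invariantTorEnd_le h hf (t := fun s => (max 1 s : ℕ) * tau b ρ)
    (β := fun q => (q + 1) * tau b ρ)
    (fun _ _ hs => mul_le_mul_of_nonneg_right (Nat.cast_le.2 (max_le_max le_rfl hs))
      (Int.natCast_nonneg _)) (by simp)
    (hilbertIdealAcyclic_of_max_mul_lt h h1) (fun q => le_rfl)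
    (fun p q hpq => by
      rw [max_eq_right (Nat.sub_pos_of_lt hpq), Nat.cast_sub hpq.le]
      exact le_of_eq (by ring)) i
  exact_mod_cast hi

end Invariants

end

theorem theorem1p2 {k : Type u} [Field k] {G : Type v} [Group G] [Finite G]
    {V : Type w} [AddCommGroup V] [Module k V] {n : ℕ} (b : Module.Basis (Fin n) k V)
    (ρ : Representation k G V)
    (hsplit : (Nat.card G : k) ≠ 0 ∨ IsSplitInvariants b ρ)
    {r : ℕ} (f : Fin r → invariantRing b ρ) (e : Fin r → ℕ)
    (hf : IsMinimalGenerators b ρ f e) (i : ℕ) :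
    (invariantTorEnd b ρ f e i ≤ ((((i : ℝ) + 1) * (tau b ρ : ℝ) + i - 1 : ℝ) : EReal) ∧
      ((i : ℝ) + 1) * (tau b ρ : ℝ) + i - 1 ≤ ((i : ℝ) + 1) * (Nat.card G : ℝ) + i - 1) ∧
    (hilbertIdealTorEnd b ρ 1 ≤ (tau b ρ : EReal) →
      invariantTorEnd b ρ f e i ≤ ((((i : ℝ) + 1) * (tau b ρ : ℝ) - 1 : ℝ) : EReal) ∧
      ((i : ℝ) + 1) * (tau b ρ : ℝ) - 1 ≤ ((i : ℝ) + 1) * (Nat.card G : ℝ) - 1) := by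
  have h : IsSplitInvariants b ρ := hsplit.elim isSplitInvariants_of_card_ne_zero id
  have hτ : (tau b ρ : ℝ) ≤ Nat.card G := Nat.cast_le.2 (tau_le_card h)
  exact ⟨⟨invariantTorEnd_le_mul_add h hf i, by gcongr⟩,
    fun h1 => ⟨invariantTorEnd_le_mul h hf h1 i, by gcongr⟩⟩
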